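/- Let $X$ be a complete geodesic metric space which is tree-graded with respect to a collection $\mathcal P$ of closed geodesic subsets (called pieces). This means that any two different pieces have at most one common point, and that every simple geodesic triangle in $X$ (a simple loop composed of three geodesics, where geodesics of length $0$ are allowed, so that a point is such a triangle) is contained in one piece. Suppose that the pieces are non-empty and locally uniformly contractible: for every $\varepsilon>0$ there is $\delta\in(0,\varepsilon]$ such that for every $M\in\mathcal P$ and every $m\in M$, the ball $B_M(m,\delta)$ of $M$ is contractible inside the ball $B_M(m,\varepsilon)$, i.e. the inclusion $B_M(m,\delta)\to B_M(m,\varepsilon)$ is homotopic to a constant map. Then the fundamental group of $X$ is the free product of the fundamental groups of the pieces. More precisely, for every $x\in X$ and every choice of base points $y_M\in M$, $M\in\mathcal P$, there are paths $\gamma_M$ in $X$ from $x$ to $y_M$ such that the homomorphism $$\mathop{*}_{M\in\mathcal P}\pi_1(M,y_M)\longrightarrow \pi_1(X,x)$$ which on each factor $\pi_1(M,y_M)$ is $[p]\mapsto[\gamma_M\, p\,\gamma_M^{-1}]$ is an isomorphism. -/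

import Mathlib

/-- `f` restricted to `[a, b]` is a geodesic (an isometric embedding of the interval). -/
def IsGeodesicOn {X : Type*} [MetricSpace X] (f : ℝ → X) (a b : ℝ) : Prop :=
  ∀ u ∈ Set.Icc a b, ∀ v ∈ Set.Icc a b, dist (f u) (f v) = |u - v|

/-- Every two points of `A` are joined by a geodesic contained in `A`. -/
def IsGeodesicSubset {X : Type*} [MetricSpace X] (A : Set X) : Prop :=
  ∀ a ∈ A, ∀ b ∈ A, ∃ f : ℝ → X, IsGeodesicOn f 0 (dist a b) ∧
    f 0 = a ∧ f (dist a b) = b ∧ f '' Set.Icc 0 (dist a b) ⊆ A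

/-- The restriction of `f` to `[0, l]` is a simple geodesic triangle: a simple loop, parametrized
by arc length, composed of the three geodesics `f|[0, s]`, `f|[s, t]`, `f|[t, l]`. Geodesics of
length `0` are allowed; in particular a point is a simple geodesic triangle (`l = 0`). -/
structure IsSimpleGeodesicTriangle {X : Type*} [MetricSpace X] (f : ℝ → X) (s t l : ℝ) :
    Prop where
  zero_le : 0 ≤ s
  le_mid : s ≤ t
  le_end : t ≤ l
  side₁ : IsGeodesicOn f 0 s
  side₂ : IsGeodesicOn f s t
  side₃ : IsGeodesicOn f t l
  closed : f 0 = f l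
  simple : Set.InjOn f (Set.Ico 0 l)

/-- `X` is tree-graded with respect to the collection of pieces `P`. -/
structure IsTreeGraded (X : Type*) [MetricSpace X] (P : Set (Set X)) : Prop where
  complete : CompleteSpace X
  geodesic : IsGeodesicSubset (Set.univ : Set X)
  isClosed_piece : ∀ M ∈ P, IsClosed M
  geodesic_piece : ∀ M ∈ P, IsGeodesicSubset M
  inter_subsingleton : ∀ M ∈ P, ∀ N ∈ P, M ≠ N → (M ∩ N).Subsingleton
  triangle : ∀ (f : ℝ → X) (s t l : ℝ), IsSimpleGeodesicTriangle f s t l →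
    ∃ M ∈ P, f '' Set.Icc 0 l ⊆ M

/-- A family of metric spaces is locally uniformly contractible if for every `ε > 0` there is
`δ > 0`, the same for all members and all points, such that every ball of radius `δ` can be
contracted to a point inside the concentric ball of radius `ε`. -/
def LocallyUniformlyContractible {ι : Type*} (Y : ι → Type*) [∀ i, MetricSpace (Y i)] : Prop :=
  ∀ ε : ℝ, 0 < ε → ∃ δ : ℝ, 0 < δ ∧ ∃ h : δ ≤ ε, ∀ (i : ι) (y : Y i),
    (ContinuousMap.inclusion (Metric.ball_subset_ball h) :
      C(Metric.ball y δ, Metric.ball y ε)).Nullhomotopic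

/-- The homomorphism `π₁(M, y) → π₁(X, x)` induced by the inclusion of the subset `M` in `X`
and a path `γ` in `X` from `x` to `y`: the class of a loop `p` goes to that of `γ p γ⁻¹`. -/
noncomputable def piOneInclusion {X : Type*} [TopologicalSpace X] (M : Set X) (y : M) {x : X}
    (γ : Path x (y : X)) : FundamentalGroup M y →* FundamentalGroup X x :=
  (FundamentalGroup.fundamentalGroupMulEquivOfPath γ).symm.toMonoidHom.comp
    (FundamentalGroup.map (⟨Subtype.val, continuous_subtype_val⟩ : C(M, X)) y)

open Filter hiding mk
open Set Topology
open Monoid (CoprodI)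
open Path.Homotopic.Quotient (mk mk_trans mk_symm mk_map map_comp trans_assoc refl_trans trans_refl
  trans_symm symm_trans)
open scoped unitInterval

/-!
A geodesic whose ends have different gates (nearest points) in a piece `M` enters and leaves `M`
through these gates, so one can choose geodesics between all pairs of points whose passages through
`M` depend only on the gates. At most one piece separates three given points, that is, has three
distinct gates for them, and outside that piece the chosen geodesics between them form a tripod. A
small triangle of chosen geodesics is therefore null-homotopic: only the part inside a piece has to
be filled, by local simple connectivity.

Inscribe in a small path the polygons of chosen geodesics given by its dyadic subdivisions.
Consecutive polygons are homotopic, with ever smaller displacement, so the infinite concatenation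
of these homotopies joins the chosen geodesic to the path itself. Hence every loop is homotopic to
a product of passages through pieces, which gives surjectivity.

For injectivity, assign to `(a, b)` the loop in the piece separating `x`, `a` and `b` (if any) run
through by the geodesic from `a` to `b`, as an element of the free product. On small triangles this
is a cocycle, so its product along a fine subdivision depends only on the homotopy class of the
path, and defines on the fundamental group a left inverse of the homomorphism.
-/

section Geodesics

variable {X : Type*} [MetricSpace X]

/-- `f` is a geodesic from `a` to `b`, parametrized by arc length on `[0, dist a b]`. -/
structure IsGeod (f : ℝ → X) (a b : X) : Prop where
  isGeodesicOn : IsGeodesicOn f 0 (dist a b)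
  map_zero : f 0 = a
  map_dist : f (dist a b) = b

namespace IsGeodesicOn

variable {f g : ℝ → X} {a b c d : ℝ}

theorem mono (hf : IsGeodesicOn f a b) (h : Icc c d ⊆ Icc a b) : IsGeodesicOn f c d :=
  fun u hu v hv => hf u (h hu) v (h hv)

theorem congr (hf : IsGeodesicOn f a b) (h : EqOn g f (Icc a b)) : IsGeodesicOn g a b :=
  fun u hu v hv => by rw [h hu, h hv, hf u hu v hv]

theorem continuousOn (hf : IsGeodesicOn f a b) : ContinuousOn f (Icc a b) :=
  (LipschitzOnWith.of_dist_le_mul (K := 1) fun u hu v hv => by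
    simp only [hf u hu v hv, Real.dist_eq, NNReal.coe_one, one_mul, le_refl]).continuousOn

theorem injOn (hf : IsGeodesicOn f a b) : InjOn f (Icc a b) := fun u hu v hv h => by
  rw [← sub_eq_zero, ← abs_eq_zero, ← hf u hu v hv, h, dist_self]

theorem comp_add_left (hf : IsGeodesicOn f (c + a) (c + b)) :
    IsGeodesicOn (fun r => f (c + r)) a b := fun u hu v hv => by
  rw [hf _ ⟨by linarith [hu.1], by linarith [hu.2]⟩ _ ⟨by linarith [hv.1], by linarith [hv.2]⟩,
    add_sub_add_left_eq_sub]

theorem comp_sub_left (hf : IsGeodesicOn f (c - b) (c - a)) :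
    IsGeodesicOn (fun r => f (c - r)) a b := fun u hu v hv => by
  rw [hf _ ⟨by linarith [hu.2], by linarith [hu.1]⟩ _ ⟨by linarith [hv.2], by linarith [hv.1]⟩,
    sub_sub_sub_cancel_left, abs_sub_comm]

theorem dist_eq (hf : IsGeodesicOn f a b) (hab : a ≤ b) : dist (f a) (f b) = b - a := by
  rw [hf a ⟨le_rfl, hab⟩ b ⟨hab, le_rfl⟩, abs_sub_comm, abs_of_nonneg (sub_nonneg.2 hab)]

theorem isGeod (hf : IsGeodesicOn f 0 b) (hb : 0 ≤ b) : IsGeod f (f 0) (f b) := by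
  have h := hf.dist_eq hb
  rw [sub_zero] at h
  exact ⟨by rwa [h], rfl, by rw [h]⟩

end IsGeodesicOn

namespace IsGeod

variable {f g : ℝ → X} {a b c : X} {s t : ℝ}

theorem dist_of_le (hf : IsGeod f a b) (hs : 0 ≤ s) (hst : s ≤ t) (ht : t ≤ dist a b) :
    dist (f s) (f t) = t - s :=
  (hf.isGeodesicOn.mono (Icc_subset_Icc hs ht)).dist_eq hst

theorem dist_left (hf : IsGeod f a b) (hs : s ∈ Icc 0 (dist a b)) : dist a (f s) = s := by
  have h := hf.dist_of_le le_rfl hs.1 hs.2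
  rwa [hf.map_zero, sub_zero] at h

theorem dist_right (hf : IsGeod f a b) (hs : s ∈ Icc 0 (dist a b)) :
    dist (f s) b = dist a b - s := by
  have h := hf.dist_of_le hs.1 hs.2 le_rfl
  rwa [hf.map_dist] at h

theorem param_eq (hf : IsGeod f a b) (hg : IsGeod g a c) (hs : s ∈ Icc 0 (dist a b))
    (ht : t ∈ Icc 0 (dist a c)) (h : f s = g t) : s = t := by
  rw [← hf.dist_left hs, h, hg.dist_left ht]

theorem continuousOn (hf : IsGeod f a b) : ContinuousOn f (Icc 0 (dist a b)) :=
  hf.isGeodesicOn.continuousOn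

theorem sub (hf : IsGeod f a b) (hs : 0 ≤ s) (hst : s ≤ t) (ht : t ≤ dist a b) :
    IsGeod (fun r => f (s + r)) (f s) (f t) := by
  have h : IsGeodesicOn (fun r => f (s + r)) 0 (t - s) := by
    refine (hf.isGeodesicOn.mono ?_).comp_add_left
    rw [add_zero, add_sub_cancel]
    exact Icc_subset_Icc hs ht
  simpa only [add_zero, add_sub_cancel] using h.isGeod (sub_nonneg.2 hst)

theorem rev (hf : IsGeod f a b) : IsGeod (fun r => f (dist a b - r)) b a where
  isGeodesicOn := by
    rw [dist_comm b a]
    refine IsGeodesicOn.comp_sub_left ?_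
    rw [sub_self, sub_zero]
    exact hf.isGeodesicOn
  map_zero := by rw [sub_zero, hf.map_dist]
  map_dist := by rw [dist_comm b a, sub_self, hf.map_zero]

theorem of_dist_le (h0 : f 0 = a) (h1 : f (dist a b) = b)
    (h : ∀ s t, 0 ≤ s → s ≤ t → t ≤ dist a b → dist (f s) (f t) ≤ t - s) : IsGeod f a b := by
  have dist_eq : ∀ s t, 0 ≤ s → s ≤ t → t ≤ dist a b → dist (f s) (f t) = t - s := by
    intro s t hs hst ht
    refine le_antisymm (h s t hs hst ht) ?_
    have h2 := h 0 s le_rfl hs (hst.trans ht)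
    have h3 := h t _ (hs.trans hst) ht le_rfl
    rw [h0] at h2
    rw [h1] at h3
    linarith [dist_triangle4 a (f s) (f t) b]
  refine ⟨fun u hu v hv => ?_, h0, h1⟩
  rcases le_total u v with huv | huv
  · rw [dist_eq u v hu.1 huv hv.2, abs_sub_comm, abs_of_nonneg (by linarith)]
  · rw [dist_comm, dist_eq v u hv.1 huv hu.2, abs_of_nonneg (by linarith)]

theorem concat (hf : IsGeod f a b) (hg : IsGeod g b c) (h : dist a c = dist a b + dist b c) :
    IsGeod (fun r => if r ≤ dist a b then f r else g (r - dist a b)) a c := by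
  have hab := dist_nonneg (x := a) (y := b)
  have hbc := dist_nonneg (x := b) (y := c)
  refine of_dist_le (by simp only [hab, if_true, hf.map_zero]) ?_ fun s t hs hst ht => ?_
  · rcases le_or_gt (dist a c) (dist a b) with hca | hac
    · obtain rfl : b = c := dist_eq_zero.1 (le_antisymm (by linarith) hbc)
      rw [if_pos hca, hf.map_dist]
    · rw [if_neg hac.not_ge, h, add_sub_cancel_left, hg.map_dist]
  · by_cases ht_left : t ≤ dist a b
    · simp only [hst.trans ht_left, ht_left, if_true]
      exact (hf.dist_of_le hs hst ht_left).le
    by_cases hs_left : s ≤ dist a b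
    · simp only [ht_left, hs_left, if_true, if_false]
      have hf_right := hf.dist_right ⟨hs, hs_left⟩
      have hg_left := hg.dist_left (s := t - dist a b) ⟨by linarith, by linarith⟩
      linarith [dist_triangle (f s) b (g (t - dist a b))]
    · simp only [ht_left, hs_left, if_false]
      rw [hg.dist_of_le (by linarith) (by linarith) (by linarith)]
      linarith

theorem continuous_clamp (hf : IsGeod f a b) :
    Continuous (fun r => f (projIcc 0 (dist a b) dist_nonneg r)) :=
  hf.continuousOn.comp_continuous (continuous_subtype_val.comp continuous_projIcc)
    fun r => (projIcc 0 (dist a b) dist_nonneg r).2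

end IsGeod

theorem isCompact_inter_preimage {Y Z : Type*} [TopologicalSpace Y] [T2Space Y]
    [TopologicalSpace Z] {f : Y → Z} {K : Set Y} {C : Set Z} (hK : IsCompact K)
    (hf : ContinuousOn f K) (hC : IsClosed C) : IsCompact (K ∩ f ⁻¹' C) :=
  hK.of_isClosed_subset (hf.preimage_isClosed_of_isClosed hK.isClosed hC) inter_subset_left

end Geodesics

section TreeGradings

variable {X : Type*} [MetricSpace X]

/-- The family `P` is a tree-grading of `X`: this is `IsTreeGraded X P` without completeness
of `X`. -/
structure IsTreeGrading (P : Set (Set X)) : Prop where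
  geodesic : IsGeodesicSubset (univ : Set X)
  isClosed_piece : ∀ M ∈ P, IsClosed M
  geodesic_piece : ∀ M ∈ P, IsGeodesicSubset M
  inter_subsingleton : ∀ M ∈ P, ∀ N ∈ P, M ≠ N → (M ∩ N).Subsingleton
  triangle : ∀ (f : ℝ → X) (s t l : ℝ), IsSimpleGeodesicTriangle f s t l →
    ∃ M ∈ P, f '' Icc 0 l ⊆ M

theorem IsTreeGraded.isTreeGrading {P : Set (Set X)} (hP : IsTreeGraded X P) : IsTreeGrading P :=
  ⟨hP.geodesic, hP.isClosed_piece, hP.geodesic_piece, hP.inter_subsingleton, hP.triangle⟩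

/-- The loop that runs through `f` on `[0, A]`, then through `g` on `[0, B]`, and then backwards
through `h` on `[0, C]`. -/
noncomputable def triangleLoop {Y : Type*} (f g h : ℝ → Y) (A B C r : ℝ) : Y :=
  if r ≤ A then f r else if r ≤ A + B then g (r - A) else h (A + B + C - r)

section TriangleLoop

variable {Y : Type*} {f g h : ℝ → Y} {A B C r : ℝ}

theorem triangleLoop_side₁ (hr : r ≤ A) : triangleLoop f g h A B C r = f r := if_pos hr

theorem triangleLoop_side₂ (hfg : f A = g 0) (hr : r ∈ Icc A (A + B)) :
    triangleLoop f g h A B C r = g (r - A) := by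
  rcases hr.1.eq_or_lt with rfl | hA
  · rw [triangleLoop_side₁ le_rfl, hfg, sub_self]
  · rw [triangleLoop, if_neg hA.not_ge, if_pos hr.2]

theorem triangleLoop_side₃ (hfg : f A = g 0) (hgh : g B = h C) (hB : 0 ≤ B) (hr : A + B ≤ r) :
    triangleLoop f g h A B C r = h (A + B + C - r) := by
  rcases hr.eq_or_lt with rfl | hAB
  · rw [triangleLoop_side₂ hfg ⟨by linarith, le_rfl⟩, add_sub_cancel_left, add_sub_cancel_left, hgh]
  · rw [triangleLoop, if_neg (by linarith), if_neg hAB.not_ge]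

theorem isSimpleGeodesicTriangle_triangleLoop {f g h : ℝ → X} (hA : 0 ≤ A) (hB : 0 ≤ B)
    (hC : 0 ≤ C) (hf : IsGeodesicOn f 0 A) (hg : IsGeodesicOn g 0 B) (hh : IsGeodesicOn h 0 C)
    (hfg : f A = g 0) (hgh : g B = h C) (hfh : f 0 = h 0)
    (dfg : ∀ s ∈ Ico 0 A, ∀ t ∈ Icc 0 B, f s ≠ g t) (dgh : ∀ s ∈ Ico 0 B, ∀ t ∈ Icc 0 C, g s ≠ h t)
    (dfh : ∀ s ∈ Icc 0 A, ∀ t ∈ Ioc 0 C, f s ≠ h t) :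
    IsSimpleGeodesicTriangle (triangleLoop f g h A B C) A (A + B) (A + B + C) := by
  have F₁ : EqOn (triangleLoop f g h A B C) f (Icc 0 A) := fun r hr => triangleLoop_side₁ hr.2
  have F₂ : EqOn (triangleLoop f g h A B C) (fun r => g (-A + r)) (Icc A (A + B)) := fun r hr => by
    simp only [triangleLoop_side₂ hfg hr, neg_add_eq_sub]
  have F₃ : EqOn (triangleLoop f g h A B C) (fun r => h (A + B + C - r))
      (Icc (A + B) (A + B + C)) := fun r hr => triangleLoop_side₃ hfg hgh hB hr.1
  have G₁ := hf.congr F₁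
  have G₂ : IsGeodesicOn (triangleLoop f g h A B C) A (A + B) :=
    IsGeodesicOn.congr (by apply IsGeodesicOn.comp_add_left; simpa using hg) F₂
  have G₃ : IsGeodesicOn (triangleLoop f g h A B C) (A + B) (A + B + C) :=
    IsGeodesicOn.congr (by apply IsGeodesicOn.comp_sub_left; simpa using hh) F₃
  refine ⟨hA, by linarith, by linarith, G₁, G₂, G₃, ?_, ?_⟩
  · simp only [F₁ ⟨le_rfl, hA⟩, F₃ ⟨by linarith, le_rfl⟩, hfh, sub_self]
  rw [← Ico_union_Ico_eq_Ico (by linarith : 0 ≤ A + B) (by linarith),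
    ← Ico_union_Ico_eq_Ico hA (by linarith),
    injOn_union (by rw [Ico_union_Ico_eq_Ico hA (by linarith)]; exact Ico_disjoint_Ico_same),
    injOn_union Ico_disjoint_Ico_same]
  refine ⟨⟨G₁.injOn.mono Ico_subset_Icc_self, G₂.injOn.mono Ico_subset_Icc_self, ?_⟩,
    G₃.injOn.mono Ico_subset_Icc_self, ?_⟩
  · intro r hr t ht
    rw [F₁ ⟨hr.1, hr.2.le⟩, F₂ ⟨ht.1, ht.2.le⟩]
    exact dfg r hr _ ⟨by linarith [ht.1], by linarith [ht.2]⟩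
  · rintro r (hr | hr) t ht
    · rw [F₁ ⟨hr.1, hr.2.le⟩, F₃ ⟨ht.1, ht.2.le⟩]
      exact dfh r ⟨hr.1, hr.2.le⟩ _ ⟨by linarith [ht.2], by linarith [ht.1]⟩
    · rw [F₂ ⟨hr.1, hr.2.le⟩, F₃ ⟨ht.1, ht.2.le⟩]
      exact dgh _ ⟨by linarith [hr.1], by linarith [hr.2]⟩ _
        ⟨by linarith [ht.2], by linarith [ht.1]⟩

end TriangleLoop

/-- The point `e` is the gate of `a` in `M`: every point of `M` is reached from `a` through `e`. -/
structure IsGate (M : Set X) (a e : X) : Prop where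
  mem : e ∈ M
  dist_eq : ∀ m ∈ M, dist a m = dist a e + dist e m

namespace IsGate

variable {M : Set X} {a b e e' : X}

theorem eq (h : IsGate M a e) (h' : IsGate M a e') : e = e' := by
  have h1 := h.dist_eq _ h'.mem
  have h2 := h'.dist_eq _ h.mem
  rw [dist_comm e' e] at h2
  exact dist_le_zero.1 (by linarith)

theorem self (h : a ∈ M) : IsGate M a a := ⟨h, fun m _ => by rw [dist_self, zero_add]⟩

theorem eq_of_mem (h : IsGate M a e) (ha : a ∈ M) : e = a := h.eq (self ha)

theorem of_between (h : IsGate M a e) (hb : dist a e = dist a b + dist b e) : IsGate M b e := by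
  refine ⟨h.mem, fun m hm => le_antisymm (dist_triangle _ _ _) ?_⟩
  have h1 := h.dist_eq m hm
  linarith [dist_triangle a b m]

theorem geod (h : IsGate M a e) {f : ℝ → X} (hf : IsGeod f a e) {s : ℝ}
    (hs : s ∈ Icc 0 (dist a e)) : IsGate M (f s) e :=
  h.of_between (by rw [hf.dist_left hs, hf.dist_right hs, add_sub_cancel])

end IsGate

namespace IsTreeGrading

variable {P : Set (Set X)} (hP : IsTreeGrading P)
include hP

theorem exists_isGeod (a b : X) : ∃ f : ℝ → X, IsGeod f a b := by
  obtain ⟨f, hf, hfa, hfb, -⟩ := hP.geodesic a (mem_univ _) b (mem_univ _)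
  exact ⟨f, hf, hfa, hfb⟩

theorem exists_isGeod_piece {M : Set X} (hM : M ∈ P) {a b : X} (ha : a ∈ M) (hb : b ∈ M) :
    ∃ f : ℝ → X, IsGeod f a b ∧ MapsTo f (Icc 0 (dist a b)) M := by
  obtain ⟨f, hf, hfa, hfb, hfM⟩ := hP.geodesic_piece M hM a ha b hb
  exact ⟨f, ⟨hf, hfa, hfb⟩, mapsTo_iff_image_subset.2 hfM⟩

theorem piece_eq {M N : Set X} (hM : M ∈ P) (hN : N ∈ P) {a b : X} (hab : a ≠ b)
    (haM : a ∈ M) (haN : a ∈ N) (hbM : b ∈ M) (hbN : b ∈ N) : M = N := by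
  by_contra h
  exact hab (hP.inter_subsingleton M hM N hN h ⟨haM, haN⟩ ⟨hbM, hbN⟩)

theorem exists_piece_of_triangle {f g h : ℝ → X} {a a' b b' c c' : ℝ} (ha : a ≤ a') (hb : b ≤ b')
    (hc : c ≤ c') (hf : IsGeodesicOn f a a') (hg : IsGeodesicOn g b b') (hh : IsGeodesicOn h c c')
    (hfg : f a' = g b) (hgh : g b' = h c') (hfh : f a = h c)
    (dfg : ∀ s ∈ Ico a a', ∀ t ∈ Icc b b', f s ≠ g t)
    (dgh : ∀ s ∈ Ico b b', ∀ t ∈ Icc c c', g s ≠ h t)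
    (dfh : ∀ s ∈ Icc a a', ∀ t ∈ Ioc c c', f s ≠ h t) :
    ∃ M ∈ P, MapsTo f (Icc a a') M ∧ MapsTo g (Icc b b') M ∧ MapsTo h (Icc c c') M := by
  have hA := sub_nonneg.2 ha
  have hB := sub_nonneg.2 hb
  have hC := sub_nonneg.2 hc
  set F : ℝ → X := fun r => f (a + r)
  set G : ℝ → X := fun r => g (b + r)
  set H : ℝ → X := fun r => h (c + r)
  have hFG : F (a' - a) = G 0 := by simpa only [F, G, add_sub_cancel, add_zero] using hfg
  have hGH : G (b' - b) = H (c' - c) := by simpa only [G, H, add_sub_cancel] using hgh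
  obtain ⟨M, hM, hsub⟩ := hP.triangle _ _ _ _ <| isSimpleGeodesicTriangle_triangleLoop
    (f := F) (g := G) (h := H) hA hB hC
    (.comp_add_left (by rwa [add_zero, add_sub_cancel]))
    (.comp_add_left (by rwa [add_zero, add_sub_cancel]))
    (.comp_add_left (by rwa [add_zero, add_sub_cancel])) hFG hGH
    (by simpa only [F, H, add_zero] using hfh)
    (fun s hs t ht => dfg _ ⟨by linarith [hs.1], by linarith [hs.2]⟩ _
      ⟨by linarith [ht.1], by linarith [ht.2]⟩)
    (fun s hs t ht => dgh _ ⟨by linarith [hs.1], by linarith [hs.2]⟩ _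
      ⟨by linarith [ht.1], by linarith [ht.2]⟩)
    (fun s hs t ht => dfh _ ⟨by linarith [hs.1], by linarith [hs.2]⟩ _
      ⟨by linarith [ht.1], by linarith [ht.2]⟩)
  refine ⟨M, hM, fun r hr => hsub ⟨r - a, ⟨by linarith [hr.1], by linarith [hr.2]⟩, ?_⟩,
    fun r hr => hsub ⟨a' - a + (r - b), ⟨by linarith [hr.1], by linarith [hr.2]⟩, ?_⟩,
    fun r hr => hsub ⟨a' - a + (b' - b) + (c' - r), ⟨by linarith [hr.2], by linarith [hr.1]⟩, ?_⟩⟩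
  · rw [triangleLoop_side₁ (by linarith [hr.2])]
    exact congrArg f (by ring)
  · rw [triangleLoop_side₂ hFG ⟨by linarith [hr.1], by linarith [hr.2]⟩]
    exact congrArg g (by ring)
  · rw [triangleLoop_side₃ hFG hGH hB (by linarith [hr.2])]
    exact congrArg h (by ring)

end IsTreeGrading

end TreeGradings

section Gates

variable {X : Type*} [MetricSpace X]

theorem IsGeod.exists_last_common {f g : ℝ → X} {x a b : X} (hf : IsGeod f x a)
    (hg : IsGeod g x b) : ∃ r, 0 ≤ r ∧ r ≤ dist x a ∧ r ≤ dist x b ∧ f r = g r ∧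
      ∀ s ∈ Icc r (dist x a), ∀ t ∈ Icc r (dist x b), f s = g t → s = r ∧ t = r := by
  set m := min (dist x a) (dist x b)
  have hma : Icc 0 m ⊆ Icc 0 (dist x a) := Icc_subset_Icc_right (min_le_left _ _)
  have hmb : Icc 0 m ⊆ Icc 0 (dist x b) := Icc_subset_Icc_right (min_le_right _ _)
  obtain ⟨r, ⟨hr, hfg⟩, hmax⟩ := (isCompact_inter_preimage isCompact_Icc
    ((hf.continuousOn.mono hma).prodMk (hg.continuousOn.mono hmb))
    isClosed_diagonal).exists_isGreatest
      ⟨0, ⟨le_rfl, le_min dist_nonneg dist_nonneg⟩, hf.map_zero.trans hg.map_zero.symm⟩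
  refine ⟨r, hr.1, (hma hr).2, (hmb hr).2, hfg, fun s hs t ht h => ?_⟩
  obtain rfl := hf.param_eq hg ⟨hr.1.trans hs.1, hs.2⟩ ⟨hr.1.trans ht.1, ht.2⟩ h
  have hsr : s = r := le_antisymm (hmax ⟨⟨hr.1.trans hs.1, le_min hs.2 ht.2⟩, h⟩) hs.1
  exact ⟨hsr, hsr⟩

theorem exists_last_first {k : ℝ → X} {l : ℝ} (hl : 0 ≤ l) (hk : ContinuousOn k (Icc 0 l))
    {A B : Set X} (hA : IsClosed A) (hB : IsClosed B) (h0 : k 0 ∈ A) (h1 : k l ∈ B) :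
    ∃ t t', 0 ≤ t ∧ t ≤ t' ∧ t' ≤ l ∧ k t ∈ A ∧ k t' ∈ B ∧
      (∀ r ∈ Icc t l, k r ∈ A → r = t) ∧ ∀ r ∈ Icc t t', k r ∈ B → r = t' := by
  obtain ⟨t, ⟨ht, htA⟩, hmax⟩ := (isCompact_inter_preimage isCompact_Icc hk hA).exists_isGreatest
    ⟨0, ⟨le_rfl, hl⟩, h0⟩
  obtain ⟨t', ⟨ht', htB⟩, hmin⟩ := (isCompact_inter_preimage isCompact_Icc
    (hk.mono (Icc_subset_Icc_left ht.1)) hB).exists_isLeast ⟨l, ⟨ht.2, le_rfl⟩, h1⟩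
  exact ⟨t, t', ht.1, ht'.1, ht'.2, htA, htB,
    fun r hr hrA => le_antisymm (hmax ⟨⟨ht.1.trans hr.1, hr.2⟩, hrA⟩) hr.1,
    fun r hr hrB => le_antisymm hr.2 (hmin ⟨⟨hr.1, hr.2.trans ht'.2⟩, hrB⟩)⟩

namespace IsTreeGrading

variable {P : Set (Set X)} (hP : IsTreeGrading P)
include hP

-- Cut `f` and `f'` at their last common point and `k` at its last point on the rest of `f` and the
-- first point after it on the rest of `f'`: the three pieces left over form a simple triangle.
theorem exists_piece_of_geodesics {f f' k : ℝ → X} {x a b : X} (hf : IsGeod f x a)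
    (hf' : IsGeod f' x b) (hk : IsGeod k a b) : ∃ M ∈ P, ∃ r s s' t t' : ℝ,
      0 ≤ r ∧ (r ≤ s ∧ s ≤ dist x a) ∧ (r ≤ s' ∧ s' ≤ dist x b) ∧
      (0 ≤ t ∧ t ≤ t' ∧ t' ≤ dist a b) ∧ (f r = f' r ∧ f s = k t ∧ f' s' = k t') ∧
      MapsTo f (Icc r s) M ∧ MapsTo f' (Icc r s') M ∧ MapsTo k (Icc t t') M := by
  obtain ⟨r, hr, hra, hrb, hfr, hlast⟩ := hf.exists_last_common hf'
  have hfc := hf.continuousOn.mono (Icc_subset_Icc_left (b := dist x a) hr)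
  have hfc' := hf'.continuousOn.mono (Icc_subset_Icc_left (b := dist x b) hr)
  obtain ⟨t, t', ht, htt', ht', ⟨s, hs, hst⟩, ⟨s', hs', hst'⟩, hlast_t, hfirst_t'⟩ :=
    exists_last_first dist_nonneg hk.continuousOn (isCompact_Icc.image_of_continuousOn hfc).isClosed
      (isCompact_Icc.image_of_continuousOn hfc').isClosed
      ⟨_, ⟨hra, le_rfl⟩, hf.map_dist.trans hk.map_zero.symm⟩
      ⟨_, ⟨hrb, le_rfl⟩, hf'.map_dist.trans hk.map_dist.symm⟩
  have hfg := hf.isGeodesicOn.mono (Icc_subset_Icc hr hs.2)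
  obtain ⟨M, hM, hfM, hkM, hfM'⟩ := hP.exists_piece_of_triangle hs.1 htt' hs'.1
    hfg (hk.isGeodesicOn.mono (Icc_subset_Icc ht ht'))
    (hf'.isGeodesicOn.mono (Icc_subset_Icc hr hs'.2)) hst hst'.symm hfr
    (fun q hq p hp h => by
      obtain rfl := hlast_t p ⟨hp.1, hp.2.trans ht'⟩ ⟨q, ⟨hq.1, hq.2.le.trans hs.2⟩, h⟩
      exact hq.2.ne (hfg.injOn ⟨hq.1, hq.2.le⟩ ⟨hs.1, le_rfl⟩ (h.trans hst.symm)))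
    (fun p hp q hq h => hp.2.ne
      (hfirst_t' p ⟨hp.1, hp.2.le⟩ ⟨q, ⟨hq.1, hq.2.trans hs'.2⟩, h.symm⟩))
    (fun p hp q hq h => hq.1.ne'
      (hlast p ⟨hp.1, hp.2.trans hs.2⟩ q ⟨hq.1.le, hq.2.trans hs'.2⟩ h).2)
  exact ⟨M, hM, r, s, s', t, t', hr, hs, hs', ⟨ht, htt', ht'⟩, ⟨hfr, hst, hst'⟩, hfM, hfM', hkM⟩

theorem exists_center (x a b : X) : ∃ M ∈ P, ∃ u ∈ M, ∃ v ∈ M, ∃ w ∈ M,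
    dist x a = dist x u + dist u v + dist v a ∧ dist x b = dist x u + dist u w + dist w b ∧
      dist a b = dist a v + dist v w + dist w b := by
  obtain ⟨f, hf⟩ := hP.exists_isGeod x a
  obtain ⟨f', hf'⟩ := hP.exists_isGeod x b
  obtain ⟨k, hk⟩ := hP.exists_isGeod a b
  obtain ⟨M, hM, r, s, s', t, t', hr, ⟨hrs, hs⟩, ⟨hrs', hs'⟩, ⟨ht, htt', ht'⟩,
    ⟨hfr, hst, hst'⟩, hfM, hfM', -⟩ := hP.exists_piece_of_geodesics hf hf' hk
  refine ⟨M, hM, f r, hfM ⟨le_rfl, hrs⟩, f s, hfM ⟨hrs, le_rfl⟩, f' s', hfM' ⟨hrs', le_rfl⟩,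
    ?_, ?_, ?_⟩
  · rw [hf.dist_left ⟨hr, hrs.trans hs⟩, hf.dist_of_le hr hrs hs, hf.dist_right ⟨hr.trans hrs, hs⟩]
    ring
  · rw [hfr, hf'.dist_left ⟨hr, hrs'.trans hs'⟩, hf'.dist_of_le hr hrs' hs',
      hf'.dist_right ⟨hr.trans hrs', hs'⟩]
    ring
  · rw [hst, hst', hk.dist_left ⟨ht, htt'.trans ht'⟩, hk.dist_of_le ht htt' ht',
      hk.dist_right ⟨ht.trans htt', ht'⟩]
    ring

theorem exists_piece_of_bigon {f g : ℝ → X} {a b : X} {l r : ℝ} (hf : IsGeod f a b)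
    (hg : IsGeod g a b) (hl : 0 ≤ l) (hlr : l ≤ r) (hr : r ≤ dist a b)
    (hfl : f l = g l) (hfr : f r = g r) (hne : ∀ s ∈ Ioo l r, f s ≠ g s) :
    ∃ M ∈ P, MapsTo f (Icc l r) M := by
  have param_eq : ∀ s ∈ Icc l r, ∀ t ∈ Icc l r, f s = g t → s = t := fun s hs t ht h =>
    hf.param_eq hg (Icc_subset_Icc hl hr hs) (Icc_subset_Icc hl hr ht) h
  obtain ⟨m, hm⟩ : ∃ m, m = (l + r) / 2 := ⟨_, rfl⟩
  obtain ⟨M, hM, hleft, hright, -⟩ := hP.exists_piece_of_triangle (by linarith : l ≤ m)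
    (by linarith : m ≤ r) hlr (hf.isGeodesicOn.mono (Icc_subset_Icc hl (by linarith)))
    (hf.isGeodesicOn.mono (Icc_subset_Icc (by linarith) hr))
    (hg.isGeodesicOn.mono (Icc_subset_Icc hl hr)) rfl hfr hfl
    (fun s hs t ht h => by
      have := hf.isGeodesicOn.injOn ⟨by linarith [hs.1], by linarith [hs.2]⟩
        ⟨by linarith [ht.1], by linarith [ht.2]⟩ h
      linarith [hs.2, ht.1])
    (fun s hs t ht h => by
      obtain rfl := param_eq s ⟨by linarith [hs.1], hs.2.le⟩ t ht h
      exact hne s ⟨by linarith [hs.1, hs.2], hs.2⟩ h)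
    (fun s hs t ht h => by
      obtain rfl := param_eq s ⟨hs.1, by linarith [hs.2]⟩ t ⟨ht.1.le, ht.2⟩ h
      exact hne s ⟨ht.1, by linarith [hs.2, ht.1]⟩ h)
  exact ⟨M, hM, fun s hs => (le_total s m).elim (fun h => hleft ⟨hs.1, h⟩)
    (fun h => hright ⟨h, hs.2⟩)⟩

theorem exists_passage_of_ne {f g : ℝ → X} {a b : X} (hf : IsGeod f a b) (hg : IsGeod g a b)
    {s : ℝ} (hs : s ∈ Icc 0 (dist a b)) (hne : f s ≠ g s) : ∃ M ∈ P, ∀ e e', IsGate M a e →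
      IsGate M b e' → dist a e < s ∧ s < dist a b - dist b e' := by
  have hleft : Icc 0 s ⊆ Icc 0 (dist a b) := Icc_subset_Icc_right hs.2
  have hright : Icc s (dist a b) ⊆ Icc 0 (dist a b) := Icc_subset_Icc_left hs.1
  obtain ⟨l, ⟨hl, hfl⟩, hl_max⟩ := (isCompact_inter_preimage isCompact_Icc
    ((hf.continuousOn.mono hleft).prodMk (hg.continuousOn.mono hleft))
    isClosed_diagonal).exists_isGreatest
      ⟨0, ⟨le_rfl, hs.1⟩, hf.map_zero.trans hg.map_zero.symm⟩
  obtain ⟨r, ⟨hr, hfr⟩, hr_min⟩ := (isCompact_inter_preimage isCompact_Icc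
    ((hf.continuousOn.mono hright).prodMk (hg.continuousOn.mono hright))
    isClosed_diagonal).exists_isLeast
      ⟨dist a b, ⟨hs.2, le_rfl⟩, hf.map_dist.trans hg.map_dist.symm⟩
  have hls : l < s := hl.2.lt_of_ne fun h => hne (h ▸ hfl)
  have hsr : s < r := hr.1.lt_of_ne fun h => hne (h ▸ hfr)
  obtain ⟨M, hM, hfM⟩ := hP.exists_piece_of_bigon hf hg hl.1 (hls.trans hsr).le hr.2 hfl hfr
    fun t ht h => (le_total t s).elim
      (fun hts => ht.1.not_ge (hl_max ⟨⟨hl.1.trans ht.1.le, hts⟩, h⟩))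
      (fun hst => ht.2.not_ge (hr_min ⟨⟨hst, ht.2.le.trans hr.2⟩, h⟩))
  refine ⟨M, hM, fun e e' he he' => ⟨lt_of_le_of_lt ?_ hls, hsr.trans_le ?_⟩⟩
  · have := he.dist_eq _ (hfM ⟨le_rfl, (hls.trans hsr).le⟩)
    rw [hf.dist_left (hleft hl)] at this
    linarith [dist_nonneg (x := e) (y := f l)]
  · have := he'.dist_eq _ (hfM ⟨(hls.trans hsr).le, le_rfl⟩)
    rw [dist_comm b (f r), hf.dist_right (hright hr)] at this
    linarith [dist_nonneg (x := e') (y := f r)]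

theorem exists_first_mem {M : Set X} (hM : M ∈ P) {f : ℝ → X} {a m : X} (hf : IsGeod f a m)
    (h : ∃ s ∈ Icc 0 (dist a m), f s ∈ M) :
    ∃ s ∈ Icc 0 (dist a m), f s ∈ M ∧ ∀ t ∈ Icc 0 s, f t ∈ M → t = s := by
  obtain ⟨s, ⟨hs, hsM⟩, hmin⟩ := (isCompact_inter_preimage isCompact_Icc hf.continuousOn
    (hP.isClosed_piece M hM)).exists_isLeast h
  exact ⟨s, hs, hsM, fun t ht htM => le_antisymm ht.2 (hmin ⟨⟨ht.1, ht.2.trans hs.2⟩, htM⟩)⟩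

theorem first_mem_unique {M : Set X} (hM : M ∈ P) {f g : ℝ → X} {a e e' : X} (hf : IsGeod f a e)
    (hg : IsGeod g a e') (he : e ∈ M) (he' : e' ∈ M)
    (hfirst : ∀ t ∈ Icc 0 (dist a e), f t ∈ M → t = dist a e)
    (hfirst' : ∀ t ∈ Icc 0 (dist a e'), g t ∈ M → t = dist a e') : e = e' := by
  by_contra hne
  obtain ⟨k, hk, hkM⟩ := hP.exists_isGeod_piece hM he he'
  obtain ⟨N, hN, r, s, s', t, t', hr, ⟨hrs, hs⟩, ⟨hrs', hs'⟩, ⟨ht, htt', ht'⟩,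
    ⟨hfg, hst, hst'⟩, hfN, hgN, -⟩ := hP.exists_piece_of_geodesics hf hg hk
  obtain rfl := hfirst s ⟨hr.trans hrs, hs⟩ (hst ▸ hkM ⟨ht, htt'.trans ht'⟩)
  obtain rfl := hfirst' s' ⟨hr.trans hrs', hs'⟩ (hst' ▸ hkM ⟨ht.trans htt', ht'⟩)
  have heN : e ∈ N := hf.map_dist ▸ hfN ⟨hrs, le_rfl⟩
  have heN' : e' ∈ N := hg.map_dist ▸ hgN ⟨hrs', le_rfl⟩
  obtain rfl := hP.piece_eq hM hN hne he heN he' heN'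
  have hr_left := hfirst r ⟨hr, hrs⟩ (hfN ⟨le_rfl, hrs⟩)
  have hr_right := hfirst' r ⟨hr, hrs'⟩ (hgN ⟨le_rfl, hrs'⟩)
  refine hne ?_
  rw [← hf.map_dist, ← hg.map_dist, ← hr_left, hfg, hr_left, ← hr_right, hr_left]

theorem exists_isGate {M : Set X} (hM : M ∈ P) (hne : M.Nonempty) (a : X) : ∃ e, IsGate M a e := by
  have exists_entry : ∀ m ∈ M, ∃ e ∈ M, dist a m = dist a e + dist e m ∧ ∃ f, IsGeod f a e ∧
      ∀ t ∈ Icc 0 (dist a e), f t ∈ M → t = dist a e := by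
    intro m hm
    obtain ⟨f, hf⟩ := hP.exists_isGeod a m
    obtain ⟨s, hs, hsM, hfirst⟩ := hP.exists_first_mem hM hf
      ⟨_, ⟨dist_nonneg, le_rfl⟩, hf.map_dist.symm ▸ hm⟩
    have hf_s := hf.sub le_rfl hs.1 hs.2
    simp only [zero_add, hf.map_zero] at hf_s
    refine ⟨f s, hsM, ?_, f, hf_s, ?_⟩
    · rw [hf.dist_left hs, hf.dist_right hs, add_sub_cancel]
    · rwa [hf.dist_left hs]
  obtain ⟨m, hm⟩ := hne
  obtain ⟨e, he, -, f, hf, hfirst⟩ := exists_entry m hm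
  refine ⟨e, he, fun m' hm' => ?_⟩
  obtain ⟨e', he', hdist, g, hg, hfirst'⟩ := exists_entry m' hm'
  rwa [hP.first_mem_unique hM hf hg he he' hfirst hfirst']

theorem geod_mem_piece {M : Set X} (hM : M ∈ P) {u v : X} (hu : u ∈ M) (hv : v ∈ M) {f : ℝ → X}
    (hf : IsGeod f u v) : MapsTo f (Icc 0 (dist u v)) M := fun s hs => by
  obtain ⟨e, he⟩ := hP.exists_isGate hM ⟨u, hu⟩ (f s)
  have hdu := he.dist_eq u hu
  have hdv := he.dist_eq v hv
  rw [dist_comm, hf.dist_left hs] at hdu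
  rw [hf.dist_right hs] at hdv
  have : dist (f s) e ≤ 0 := by
    linarith [dist_triangle u e v, dist_comm u e, dist_nonneg (x := f s) (y := e)]
  rw [dist_le_zero.1 this]
  exact he.mem

-- If `k` avoided `M`, the triangle spanned by `k`, by a geodesic from `e'` through `e` to `a` and
-- by one from `e'` to `b` would contain a simple triangle with a side passing through `e` and `e'`.
theorem exists_mem_of_gate_ne {M : Set X} (hM : M ∈ P) {a b e e' : X} (ha : IsGate M a e)
    (hb : IsGate M b e') (hne : e ≠ e') {k : ℝ → X} (hk : IsGeod k a b) :
    ∃ s ∈ Icc 0 (dist a b), k s ∈ M := by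
  by_contra! hkM
  obtain ⟨h, hh, hhM⟩ := hP.exists_isGeod_piece hM hb.mem ha.mem
  obtain ⟨f, hf⟩ := hP.exists_isGeod a e
  obtain ⟨g, hg⟩ := hP.exists_isGeod b e'
  have hF := hh.concat hf.rev (by
    rw [dist_comm e' a, ha.dist_eq _ hb.mem, dist_comm e' e, dist_comm e a, add_comm])
  set F := fun r => if r ≤ dist e' e then h r else f (dist a e - (r - dist e' e)) with F_def
  have F_left : ∀ r ∈ Icc 0 (dist e' e), F r ∈ M := fun r hr => by
    simpa only [F_def, if_pos hr.2] using hhM hr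
  have F_right : ∀ r, dist e' e ≤ r → r ≤ dist e' a → IsGate M (F r) e := fun r hr hra => by
    rcases hr.eq_or_lt with rfl | hr'
    · simp only [F_def, if_pos le_rfl, hh.map_dist]
      exact .self ha.mem
    · simp only [F_def, if_neg hr'.not_ge]
      have := ha.dist_eq _ hb.mem
      rw [dist_comm a e', dist_comm e e'] at this
      exact ha.geod hf ⟨by linarith, by linarith⟩
  have G_gate : ∀ r ∈ Icc 0 (dist e' b), IsGate M (g (dist b e' - r)) e' := fun r hr =>
    hb.geod hg ⟨by linarith [hr.2, dist_comm b e'], by linarith [hr.1]⟩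
  obtain ⟨N, hN, r, s, s', t, t', hr, ⟨hrs, hs⟩, ⟨hrs', hs'⟩, ⟨ht, htt', ht'⟩,
    ⟨hFG, hst, -⟩, hFN, -, hkN⟩ := hP.exists_piece_of_geodesics hF hg.rev hk
  have hr_gate := G_gate r ⟨hr, hrs'.trans hs'⟩
  rw [← hFG] at hr_gate
  have hr_lt : r < dist e' e := not_le.1 fun h =>
    hne ((F_right r h (hrs.trans hs)).eq hr_gate)
  have hs_lt : dist e' e < s := not_le.1 fun h =>
    hkM t ⟨ht, htt'.trans ht'⟩ (hst ▸ F_left s ⟨hr.trans hrs, h⟩)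
  have heN : e ∈ N := by simpa [F_def, hh.map_dist] using hFN ⟨hr_lt.le, hs_lt.le⟩
  have heN' : e' ∈ N := by
    rw [hr_gate.eq_of_mem (F_left r ⟨hr, hr_lt.le⟩)]
    exact hFN ⟨le_rfl, hrs⟩
  obtain rfl := hP.piece_eq hM hN hne ha.mem heN hb.mem heN'
  exact hkM t ⟨ht, htt'.trans ht'⟩ (hkN ⟨le_rfl, htt'⟩)

theorem exists_eq_gate {M : Set X} (hM : M ∈ P) {a b e e' : X} (ha : IsGate M a e)
    (hb : IsGate M b e') (hne : e ≠ e') {k : ℝ → X} (hk : IsGeod k a b) :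
    ∃ s ∈ Icc 0 (dist a b), k s = e := by
  obtain ⟨s, hs, hsM, hfirst⟩ :=
    hP.exists_first_mem hM hk (hP.exists_mem_of_gate_ne hM ha hb hne hk)
  refine ⟨s, hs, ?_⟩
  have gate_before : ∀ t, 0 ≤ t → t < s → IsGate M (k t) e := by
    intro t ht hts
    obtain ⟨e₁, he₁⟩ := hP.exists_isGate hM ⟨e, ha.mem⟩ (k t)
    have hkt := hk.sub le_rfl ht (hts.le.trans hs.2)
    simp only [hk.map_zero, zero_add] at hkt
    by_cases h : e = e₁
    · rwa [h]
    obtain ⟨r, hr, hrM⟩ := hP.exists_mem_of_gate_ne hM ha he₁ h hkt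
    rw [hk.dist_left ⟨ht, hts.le.trans hs.2⟩] at hr
    linarith [hfirst r ⟨hr.1, hr.2.trans hts.le⟩ hrM, hr.2]
  rcases hs.1.eq_or_lt with rfl | hs0
  · rw [hk.map_zero] at hsM ⊢
    exact (ha.eq_of_mem hsM).symm
  refine (dist_le_zero.1 (le_of_forall_pos_le_add fun ε hε => ?_)).symm
  have ht : max 0 (s - ε) < s := max_lt hs0 (by linarith)
  have hd := (gate_before _ (le_max_left _ _) ht).dist_eq _ hsM
  rw [hk.dist_of_le (le_max_left _ _) ht.le hs.2] at hd
  linarith [dist_nonneg (x := k (max 0 (s - ε))) (y := e), le_max_right 0 (s - ε)]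

theorem geod_gate {M : Set X} (hM : M ∈ P) {a b e e' : X} (ha : IsGate M a e)
    (hb : IsGate M b e') (hne : e ≠ e') {k : ℝ → X} (hk : IsGeod k a b) :
    dist a e ≤ dist a b ∧ k (dist a e) = e := by
  obtain ⟨s, hs, rfl⟩ := hP.exists_eq_gate hM ha hb hne hk
  rw [hk.dist_left hs]
  exact ⟨hs.2, rfl⟩

theorem dist_gate {M : Set X} (hM : M ∈ P) {a b e e' : X} (ha : IsGate M a e)
    (hb : IsGate M b e') (hne : e ≠ e') : dist a b = dist a e + dist e e' + dist e' b := by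
  obtain ⟨k, hk⟩ := hP.exists_isGeod a b
  obtain ⟨hle, hke⟩ := hP.geod_gate hM ha hb hne hk
  have heb := hk.dist_right ⟨dist_nonneg, hle⟩
  have hbe := hb.dist_eq e ha.mem
  rw [hke] at heb
  rw [dist_comm b e, dist_comm b e', dist_comm e' e] at hbe
  linarith

theorem dist_gate_le {M : Set X} (hM : M ∈ P) {a b e e' : X} (ha : IsGate M a e)
    (hb : IsGate M b e') : dist e e' ≤ dist a b := by
  by_cases h : e = e'
  · rw [h, dist_self]
    exact dist_nonneg
  · linarith [hP.dist_gate hM ha hb h, dist_nonneg (x := a) (y := e),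
      dist_nonneg (x := e') (y := b)]

theorem gate_eq_of_mem_piece {M N : Set X} (hM : M ∈ P) (hN : N ∈ P) (hMN : M ≠ N) {a b e e' : X}
    (haN : a ∈ N) (hbN : b ∈ N) (ha : IsGate M a e) (hb : IsGate M b e') : e = e' := by
  by_contra hne
  obtain ⟨k, hk⟩ := hP.exists_isGeod a b
  obtain ⟨hle, hke⟩ := hP.geod_gate hM ha hb hne hk
  obtain ⟨hle', hke'⟩ := hP.geod_gate hM hb ha (Ne.symm hne) hk.rev
  have heN : e ∈ N := hke ▸ hP.geod_mem_piece hN haN hbN hk ⟨dist_nonneg, hle⟩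
  have heN' : e' ∈ N := hke' ▸ hP.geod_mem_piece hN hbN haN hk.rev ⟨dist_nonneg, hle'⟩
  exact hMN (hP.piece_eq hM hN hne ha.mem heN hb.mem heN')

theorem gate_eq_or {M N : Set X} (hM : M ∈ P) (hN : N ∈ P) (hMN : M ≠ N) {a m n p q c c' : X}
    (hp : IsGate M a p) (hq : IsGate N a q) (hn : n ∈ N) (hc : IsGate M n c) (hm : m ∈ M)
    (hc' : IsGate N m c') : p = c ∨ q = c' := by
  by_contra! h
  obtain ⟨cq, hcq⟩ := hP.exists_isGate hM ⟨p, hp.mem⟩ q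
  obtain rfl := hP.gate_eq_of_mem_piece hM hN hMN hq.mem hn hcq hc
  obtain ⟨cp, hcp⟩ := hP.exists_isGate hN ⟨q, hq.mem⟩ p
  obtain rfl := hP.gate_eq_of_mem_piece hN hM (Ne.symm hMN) hp.mem hm hcp hc'
  have : dist cp q ≤ 0 := by
    linarith [hP.dist_gate hM hp hcq h.1, hcp.dist_eq q hq.mem, hq.dist_eq cp hcp.mem,
      hcq.dist_eq p hp.mem, dist_triangle a p cp, dist_comm q cp, dist_comm q p, dist_comm p cq,
      dist_comm q cq]
  exact h.2 (dist_le_zero.1 this).symm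

theorem piece_unique {M N : Set X} (hM : M ∈ P) (hN : N ∈ P) {a₁ a₂ a₃ p₁ p₂ p₃ q₁ q₂ q₃ : X}
    (hp₁ : IsGate M a₁ p₁) (hp₂ : IsGate M a₂ p₂) (hp₃ : IsGate M a₃ p₃)
    (hq₁ : IsGate N a₁ q₁) (hq₂ : IsGate N a₂ q₂) (hq₃ : IsGate N a₃ q₃)
    (p12 : p₁ ≠ p₂) (p13 : p₁ ≠ p₃) (p23 : p₂ ≠ p₃)
    (q12 : q₁ ≠ q₂) (q13 : q₁ ≠ q₃) (q23 : q₂ ≠ q₃) : M = N := by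
  by_contra hMN
  obtain ⟨c, hc⟩ := hP.exists_isGate hM ⟨_, hp₁.mem⟩ q₁
  obtain ⟨c', hc'⟩ := hP.exists_isGate hN ⟨_, hq₁.mem⟩ p₁
  have h₁ := hP.gate_eq_or hM hN hMN hp₁ hq₁ hq₁.mem hc hp₁.mem hc'
  have h₂ := hP.gate_eq_or hM hN hMN hp₂ hq₂ hq₁.mem hc hp₁.mem hc'
  have h₃ := hP.gate_eq_or hM hN hMN hp₃ hq₃ hq₁.mem hc hp₁.mem hc'
  -- Two of the three points fall into the same alternative, so share a gate.
  grind

end IsTreeGrading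

end Gates

section Straightening

variable {X : Type*} [MetricSpace X] {P : Set (Set X)}

/-- A choice of gates and of a geodesic between any two points, such that the geodesics from `p`
to `q` and from `q` to `p` are inverse to each other and every geodesic traverses each piece along
the geodesic chosen for the two gates: all passages with the same end points coincide. -/
structure StraightGeodesics (P : Set (Set X)) where
  gate (M : P) (a : X) : (M : Set X)
  isGate (M : P) (a : X) : IsGate (M : Set X) a (gate M a)
  geod : X → X → ℝ → X
  isGeod (p q : X) : IsGeod (geod p q) p q
  symm (p q : X) : ∀ s ∈ Icc 0 (dist p q), geod q p s = geod p q (dist p q - s)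
  straight (M : P) (p q : X) : gate M p ≠ gate M q → ∀ s ∈ Icc 0 (dist (gate M p) (gate M q)),
    geod p q (dist p (gate M p) + s) = geod (gate M p) (gate M q) s

theorem IsTreeGrading.exists_symm_geod (hP : IsTreeGrading P) : ∃ g : X → X → ℝ → X,
    (∀ p q, IsGeod (g p q) p q) ∧
      ∀ p q, ∀ s ∈ Icc 0 (dist p q), g q p s = g p q (dist p q - s) := by
  classical
  choose f hf using hP.exists_isGeod
  refine ⟨fun p q s => if WellOrderingRel p q then f p q s else f q p (dist q p - s),
    fun p q => ?_, fun p q s hs => ?_⟩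
  · by_cases h : WellOrderingRel p q
    · simpa only [h, if_true] using hf p q
    · simpa only [h, if_false] using (hf q p).rev
  · rcases trichotomous_of WellOrderingRel p q with h | rfl | h
    · simp only [h, asymm_of WellOrderingRel h, if_true, if_false]
    · obtain rfl : s = 0 := by simpa using hs
      simp only [dist_self, sub_zero]
    · simp only [h, asymm_of WellOrderingRel h, if_true, if_false, dist_comm q p, sub_sub_cancel]

namespace IsTreeGrading

theorem geod_gate_right (hP : IsTreeGrading P) {M : Set X} (hM : M ∈ P) {a b e e' : X}
    (ha : IsGate M a e) (hb : IsGate M b e') (hne : e ≠ e') {k : ℝ → X} (hk : IsGeod k a b) :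
    k (dist a b - dist b e') = e' :=
  (hP.geod_gate hM hb ha hne.symm hk.rev).2

theorem isGeod_gates (hP : IsTreeGrading P) {M : Set X} (hM : M ∈ P) {a b e e' : X}
    (ha : IsGate M a e) (hb : IsGate M b e') (hne : e ≠ e') {k : ℝ → X} (hk : IsGeod k a b) :
    IsGeod (fun r => k (dist a e + r)) e e' := by
  have hdist := hP.dist_gate hM ha hb hne
  have hsub := hk.sub (s := dist a e) (t := dist a b - dist b e') dist_nonneg
    (by linarith [dist_comm b e', dist_nonneg (x := e) (y := e')]) (sub_le_self _ dist_nonneg)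
  rwa [(hP.geod_gate hM ha hb hne hk).2, hP.geod_gate_right hM ha hb hne hk] at hsub

end IsTreeGrading

/-- The open interval of parameters which a geodesic from `p` to `q` spends between its gates in
the piece `M`; it is empty if the two gates coincide. -/
def passage (gate : (M : P) → X → (M : Set X)) (M : P) (p q : X) : Set ℝ :=
  Ioo (dist p (gate M p)) (dist p q - dist q (gate M q))

open Classical in
/-- The geodesic `g p q` with its passage through each piece `M` replaced by `g e e'`, where `e`
and `e'` are the gates of `p` and `q` in `M`. -/
noncomputable def straighten (gate : (M : P) → X → (M : Set X)) (g : X → X → ℝ → X) (p q : X)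
    (s : ℝ) : X :=
  if h : ∃ M : P, s ∈ passage gate M p q then
    g (gate h.choose p) (gate h.choose q) (s - dist p (gate h.choose p))
  else g p q s

variable {gate : (M : P) → X → (M : Set X)} {g : X → X → ℝ → X} {M N : P} {p q : X} {s : ℝ}

theorem straighten_of_notMem (hs : ∀ M : P, s ∉ passage gate M p q) :
    straighten gate g p q s = g p q s :=
  dif_neg (not_exists.2 hs)

theorem passage_symm (hs : s ∈ passage gate M q p) : dist p q - s ∈ passage gate M p q :=
  ⟨by linarith [hs.2, dist_comm p q], by linarith [hs.1]⟩

theorem passage_subset : passage gate M p q ⊆ Icc 0 (dist p q) := fun _ hs =>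
  ⟨dist_nonneg.trans hs.1.le, hs.2.le.trans (sub_le_self _ dist_nonneg)⟩

theorem gate_ne_of_mem_passage (hs : s ∈ passage gate M p q) : (gate M p : X) ≠ gate M q :=
  fun h => by
    have h1 := hs.1.trans hs.2
    rw [h] at h1
    linarith [dist_triangle_right p q (gate M q)]

namespace IsTreeGrading

variable (hP : IsTreeGrading P) (hgate : ∀ (M : P) a, IsGate (M : Set X) a (gate M a))
include hP hgate

theorem dist_of_mem_passage (hs : s ∈ passage gate M p q) :
    dist p q = dist p (gate M p) + dist (gate M p : X) (gate M q) + dist q (gate M q) := by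
  rw [dist_comm q]
  exact hP.dist_gate M.2 (hgate M p) (hgate M q) (gate_ne_of_mem_passage hs)

theorem geod_mem_of_mem_passage {f : ℝ → X} (hf : IsGeod f p q) (hs : s ∈ passage gate M p q) :
    f s ∈ (M : Set X) := by
  have hsub := hP.isGeod_gates M.2 (hgate M p) (hgate M q) (gate_ne_of_mem_passage hs) hf
  have hmem := hP.geod_mem_piece M.2 (gate M p).2 (gate M q).2 hsub
    (x := s - dist p (gate M p)) ⟨by linarith [hs.1], by
      linarith [hs.2, hP.dist_of_mem_passage hgate hs]⟩
  rwa [add_sub_cancel] at hmem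

theorem eq_of_mem_passage (hs : s ∈ passage gate M p q) (hs' : s ∈ passage gate N p q) :
    M = N := by
  obtain ⟨f, hf⟩ := hP.exists_isGeod p q
  obtain ⟨t, hst, ht⟩ := exists_between (lt_min hs.2 hs'.2)
  have ht_mem : t ∈ passage gate M p q := ⟨hs.1.trans hst, ht.trans_le (min_le_left _ _)⟩
  have ht_mem' : t ∈ passage gate N p q := ⟨hs'.1.trans hst, ht.trans_le (min_le_right _ _)⟩
  refine Subtype.ext (hP.piece_eq M.2 N.2 (fun h => hst.ne ?_)
    (hP.geod_mem_of_mem_passage hgate hf hs) (hP.geod_mem_of_mem_passage hgate hf hs')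
    (hP.geod_mem_of_mem_passage hgate hf ht_mem) (hP.geod_mem_of_mem_passage hgate hf ht_mem'))
  exact hf.isGeodesicOn.injOn (passage_subset hs) (passage_subset ht_mem) h

theorem straighten_of_mem (hs : s ∈ passage gate M p q) :
    straighten gate g p q s = g (gate M p) (gate M q) (s - dist p (gate M p)) := by
  have h : ∃ M : P, s ∈ passage gate M p q := ⟨M, hs⟩
  rw [straighten, dif_pos h, hP.eq_of_mem_passage hgate h.choose_spec hs]

theorem le_of_passage_ne (hMN : M ≠ N) {t : ℝ} (hst : s ≤ t) (hs : s ∈ passage gate M p q)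
    (ht : t ∈ passage gate N p q) : dist p q - dist q (gate M q) ≤ dist p (gate N p) := by
  by_contra! h
  obtain ⟨r, hr, hr'⟩ := exists_between (lt_min (max_lt hs.2 h) (max_lt (hst.trans_lt ht.2)
    (ht.1.trans ht.2)))
  rw [max_lt_iff] at hr
  rw [lt_min_iff] at hr'
  exact hMN (hP.eq_of_mem_passage hgate ⟨hs.1.trans hr.1, hr'.1⟩ ⟨hr.2, hr'.2⟩)

theorem straighten_symm (hsymm : ∀ p q, ∀ s ∈ Icc 0 (dist p q), g q p s = g p q (dist p q - s))
    (hs : s ∈ Icc 0 (dist p q)) :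
    straighten gate g q p s = straighten gate g p q (dist p q - s) := by
  by_cases h : ∃ M : P, s ∈ passage gate M q p
  · obtain ⟨M, hM⟩ := h
    have hdist := hP.dist_of_mem_passage hgate hM
    have hcomm := dist_comm (gate M q : X) (gate M p)
    rw [hP.straighten_of_mem hgate hM, hP.straighten_of_mem hgate (passage_symm hM),
      hsymm _ _ _ ⟨by linarith [hM.1], by linarith [hM.2]⟩]
    congr 1
    linarith [dist_comm p q]
  · rw [straighten_of_notMem (not_exists.1 h), straighten_of_notMem, hsymm p q s hs]
    intro M hM
    have := passage_symm hM
    rw [dist_comm q p, sub_sub_cancel] at this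
    exact h ⟨M, this⟩

variable (hg : ∀ p q, IsGeod (g p q) p q)
include hg

theorem dist_straighten_left (hs : s ∈ passage gate M p q) :
    dist (g p q (dist p (gate M p))) (straighten gate g p q s) = s - dist p (gate M p) := by
  have hne := gate_ne_of_mem_passage hs
  rw [hP.straighten_of_mem hgate hs,
    (hP.geod_gate M.2 (hgate M p) (hgate M q) hne (hg p q)).2, (hg _ _).dist_left]
  exact ⟨by linarith [hs.1], by linarith [hs.2, hP.dist_of_mem_passage hgate hs]⟩

theorem dist_straighten_right (hs : s ∈ passage gate M p q) :
    dist (straighten gate g p q s) (g p q (dist p q - dist q (gate M q))) =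
      dist p q - dist q (gate M q) - s := by
  have hne := gate_ne_of_mem_passage hs
  rw [hP.straighten_of_mem hgate hs,
    hP.geod_gate_right M.2 (hgate M p) (hgate M q) hne (hg p q), (hg _ _).dist_right]
  · linarith [hP.dist_of_mem_passage hgate hs]
  · exact ⟨by linarith [hs.1], by linarith [hs.2, hP.dist_of_mem_passage hgate hs]⟩

theorem dist_straighten_le {t : ℝ} (h0 : 0 ≤ s) (hst : s ≤ t) (h1 : t ≤ dist p q) :
    dist (straighten gate g p q s) (straighten gate g p q t) ≤ t - s := by
  by_cases hs : ∃ M : P, s ∈ passage gate M p q <;> by_cases ht : ∃ N : P, t ∈ passage gate N p q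
  · obtain ⟨M, hM⟩ := hs
    obtain ⟨N, hN⟩ := ht
    rcases eq_or_ne M N with rfl | hMN
    · rw [hP.straighten_of_mem hgate hM, hP.straighten_of_mem hgate hN, (hg _ _).dist_of_le]
      all_goals linarith [hM.1, hN.2, hP.dist_of_mem_passage hgate hN]
    · have hmid := (hg p q).dist_of_le (dist_nonneg.trans (hM.1.trans hM.2).le)
        (hP.le_of_passage_ne hgate hMN hst hM hN) (hN.1.le.trans h1)
      linarith [hP.dist_straighten_left hgate hg hN, hP.dist_straighten_right hgate hg hM,
        dist_triangle4 (straighten gate g p q s) (g p q (dist p q - dist q (gate M q)))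
          (g p q (dist p (gate N p))) (straighten gate g p q t)]
  · obtain ⟨M, hM⟩ := hs
    have hle : dist p q - dist q (gate M q) ≤ t := by
      by_contra! h
      exact ht ⟨M, hM.1.trans_le hst, h⟩
    rw [straighten_of_notMem (not_exists.1 ht)]
    linarith [hP.dist_straighten_right hgate hg hM,
      (hg p q).dist_of_le (dist_nonneg.trans (hM.1.trans hM.2).le) hle h1,
      dist_triangle (straighten gate g p q s) (g p q (dist p q - dist q (gate M q))) (g p q t)]
  · obtain ⟨N, hN⟩ := ht
    have hle : s ≤ dist p (gate N p) := by
      by_contra! h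
      exact hs ⟨N, h, hst.trans_lt hN.2⟩
    rw [straighten_of_notMem (not_exists.1 hs)]
    linarith [hP.dist_straighten_left hgate hg hN,
      (hg p q).dist_of_le h0 hle (hN.1.le.trans h1),
      dist_triangle (g p q s) (g p q (dist p (gate N p))) (straighten gate g p q t)]
  · rw [straighten_of_notMem (not_exists.1 hs), straighten_of_notMem (not_exists.1 ht),
      (hg p q).dist_of_le h0 hst h1]

theorem isGeod_straighten (p q : X) : IsGeod (straighten gate g p q) p q := by
  refine IsGeod.of_dist_le ?_ ?_ fun s t => hP.dist_straighten_le hgate hg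
  · rw [straighten_of_notMem fun M h => h.1.not_ge dist_nonneg, (hg p q).map_zero]
  · rw [straighten_of_notMem fun M h => h.2.not_ge (sub_le_self _ dist_nonneg), (hg p q).map_dist]

theorem straighten_gates (hne : (gate M p : X) ≠ gate M q)
    (hs : s ∈ Icc 0 (dist (gate M p : X) (gate M q))) :
    straighten gate g p q (dist p (gate M p) + s) =
      straighten gate g (gate M p) (gate M q) s := by
  have hpq := hP.isGeod_straighten hgate hg p q
  have hmid := hP.isGeod_straighten hgate hg (gate M p) (gate M q)
  have hsub := hP.isGeod_gates M.2 (hgate M p) (hgate M q) hne hpq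
  rcases hs.1.eq_or_lt with rfl | h0
  · exact hsub.map_zero.trans hmid.map_zero.symm
  rcases hs.2.eq_or_lt with rfl | h1
  · exact hsub.map_dist.trans hmid.map_dist.symm
  have hdist := hP.dist_gate M.2 (hgate M p) (hgate M q) hne
  have hp := (hgate M (gate M p)).eq_of_mem (gate M p).2
  have hq := (hgate M (gate M q)).eq_of_mem (gate M q).2
  rw [hP.straighten_of_mem hgate (M := M), hP.straighten_of_mem hgate (M := M), hp, hq]
  · simp only [add_sub_cancel_left, dist_self, sub_zero]
  · rw [passage, hp, hq]
    simpa only [dist_self, sub_zero] using ⟨h0, h1⟩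
  · exact ⟨by linarith, by linarith [dist_comm q (gate M q)]⟩

end IsTreeGrading

theorem IsTreeGrading.nonempty_straightGeodesics (hP : IsTreeGrading P)
    (hne : ∀ M ∈ P, M.Nonempty) : Nonempty (StraightGeodesics P) := by
  choose gate hgate using fun (M : P) a => hP.exists_isGate M.2 (hne M M.2) a
  obtain ⟨g, hg, hsymm⟩ := hP.exists_symm_geod
  let gate' (M : P) (a : X) : (M : Set X) := ⟨gate M a, (hgate M a).mem⟩
  exact ⟨{
    gate := gate'
    isGate := hgate
    geod := straighten gate' g
    isGeod := hP.isGeod_straighten hgate hg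
    symm := fun p q s => hP.straighten_symm (gate := gate') hgate hsymm
    straight := fun M p q h s hs => hP.straighten_gates hgate hg (Subtype.coe_injective.ne h) hs }⟩

end Straightening

section PathClasses

/-- Homotopy classes, relative to the end points, of paths from `a` to `b`. -/
abbrev PathClass {Y : Type*} [TopologicalSpace Y] (a b : Y) : Type _ :=
  Path.Homotopic.Quotient a b

/-- The inclusion of a subspace as a continuous map. -/
def subtypeVal {Y : Type*} [TopologicalSpace Y] (S : Set Y) : C(S, Y) :=
  ⟨Subtype.val, continuous_subtype_val⟩

/-- The path `γ` regarded as a path in the subspace `S`. -/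
def restrictPath {Y : Type*} [TopologicalSpace Y] {S : Set Y} {a b : S} (γ : Path (a : Y) b)
    (h : ∀ t, γ t ∈ S) : Path a b where
  toFun t := ⟨γ t, h t⟩
  source' := Subtype.ext γ.source
  target' := Subtype.ext γ.target

namespace PathClass

variable {Y Z : Type*} [TopologicalSpace Y] [TopologicalSpace Z] {a b c d : Y}

theorem symm_trans_cancel (p : PathClass a b) (q : PathClass b c) :
    p.symm.trans (p.trans q) = q := by
  rw [← trans_assoc, symm_trans, refl_trans]

theorem trans_symm_cancel (p : PathClass a b) (q : PathClass a c) :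
    p.trans (p.symm.trans q) = q := by
  rw [← trans_assoc, trans_symm, refl_trans]

theorem symm_of_trans (p : PathClass a b) (q : PathClass b c) :
    (p.trans q).symm = q.symm.trans p.symm := by
  induction p using Path.Homotopic.Quotient.ind with | mk p =>
  induction q using Path.Homotopic.Quotient.ind with | mk q =>
  simp only [← mk_trans, ← mk_symm, Path.trans_symm]

theorem map_symm (p : PathClass a b) (f : C(Y, Z)) : p.symm.map f = (p.map f).symm := by
  induction p using Path.Homotopic.Quotient.ind with | mk p =>
  simp only [← mk_symm, ← mk_map, Path.map_symm]

theorem map_trans (p : PathClass a b) (q : PathClass b c) (f : C(Y, Z)) :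
    (p.trans q).map f = (p.map f).trans (q.map f) := by
  induction p using Path.Homotopic.Quotient.ind with | mk p =>
  induction q using Path.Homotopic.Quotient.ind with | mk q =>
  simp only [← mk_trans, ← mk_map, Path.map_trans]

theorem mk_trans_mk_of_simplyConnected [SimplyConnectedSpace Z] (f : C(Z, Y)) {u v w : Z}
    (α' : Path u v) (β' : Path v w) (γ' : Path u w) {α : Path a b} {β : Path b c} {γ : Path a c}
    (hα : ∀ r, α r = f (α' r)) (hβ : ∀ r, β r = f (β' r)) (hγ : ∀ r, γ r = f (γ' r)) :
    (mk α).trans (mk β) = mk γ := by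
  obtain rfl : f u = a := by simpa using (hα 0).symm
  obtain rfl : f v = b := by simpa using (hα 1).symm
  obtain rfl : f w = c := by simpa using (hβ 1).symm
  obtain rfl : α = α'.map f.continuous := Path.ext (funext hα)
  obtain rfl : β = β'.map f.continuous := Path.ext (funext hβ)
  obtain rfl : γ = γ'.map f.continuous := Path.ext (funext hγ)
  rw [← mk_trans, ← Path.map_trans]
  exact Path.Homotopic.Quotient.eq.2 ((SimplyConnectedSpace.paths_homotopic _ _).map f)

end PathClass

end PathClasses

/-- A point lying between any two of the points `p`, `q`, `r`. -/
structure IsMedian {X : Type*} [MetricSpace X] (p q r m : X) : Prop where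
  dist₁₂ : dist p q = dist p m + dist m q
  dist₂₃ : dist q r = dist q m + dist m r
  dist₁₃ : dist p r = dist p m + dist m r

namespace IsMedian

variable {X : Type*} [MetricSpace X] {p q r m : X}

theorem rotate (h : IsMedian p q r m) : IsMedian q r p m where
  dist₁₂ := h.dist₂₃
  dist₂₃ := by rw [dist_comm, h.dist₁₃, dist_comm p, dist_comm r, add_comm]
  dist₁₃ := by rw [dist_comm, h.dist₁₂, dist_comm p, dist_comm q, add_comm]

theorem swap (h : IsMedian p q r m) : IsMedian p r q m where
  dist₁₂ := h.dist₁₃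
  dist₂₃ := by rw [dist_comm, h.dist₂₃, dist_comm q, dist_comm r, add_comm]
  dist₁₃ := h.dist₁₂

end IsMedian

namespace StraightGeodesics

section Separation

variable {X : Type*} [MetricSpace X] {P : Set (Set X)} (G : StraightGeodesics P)

/-- The piece `M` separates the three points: their gates in `M` are pairwise distinct. -/
structure Separates (M : P) (p q r : X) : Prop where
  ne₁₂ : G.gate M p ≠ G.gate M q
  ne₂₃ : G.gate M q ≠ G.gate M r
  ne₁₃ : G.gate M p ≠ G.gate M r

variable {G} {M N : P} {p q r m : X}

theorem Separates.reverse (h : G.Separates M p q r) : G.Separates M r q p :=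
  ⟨h.ne₂₃.symm, h.ne₁₂.symm, h.ne₁₃.symm⟩

theorem Separates.rotate (h : G.Separates M p q r) : G.Separates M q r p :=
  ⟨h.ne₂₃, h.ne₁₃.symm, h.ne₁₂.symm⟩

theorem gate_eq_self (hp : p ∈ (M : Set X)) : (G.gate M p : X) = p :=
  (G.isGate M p).eq_of_mem hp

theorem gate_gate : G.gate M (G.gate M p) = G.gate M p :=
  Subtype.ext (gate_eq_self (G.gate M p).2)

variable (hP : IsTreeGrading P)
include hP

theorem dist_gates (hne : G.gate M p ≠ G.gate M q) :
    dist p q = dist p (G.gate M p) + dist (G.gate M p : X) (G.gate M q) + dist (G.gate M q : X) q :=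
  hP.dist_gate M.2 (G.isGate M p) (G.isGate M q) (Subtype.coe_injective.ne hne)

theorem dist_gate_le : dist (G.gate M p : X) (G.gate M q) ≤ dist p q :=
  hP.dist_gate_le M.2 (G.isGate M p) (G.isGate M q)

theorem gate_eq_of_between (h : dist p q = dist p m + dist m q)
    (hpq : G.gate M p = G.gate M q) : G.gate M m = G.gate M p := by
  by_contra hne
  have h1 := dist_gates hP (Ne.symm hne)
  have h2 := dist_gates hP (hpq ▸ hne)
  have h3 := dist_triangle p (G.gate M p) q
  rw [← hpq] at h2
  refine Subtype.coe_injective.ne hne (dist_le_zero.1 ?_)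
  linarith [dist_comm (G.gate M p : X) (G.gate M m), dist_nonneg (x := (G.gate M m : X)) (y := m),
    dist_comm m (G.gate M m), dist_nonneg (x := (G.gate M p : X)) (y := G.gate M m)]

theorem not_separates_gate (hne : G.gate M p ≠ G.gate M q) :
    ¬ G.Separates N p (G.gate M p) q := fun hN => by
  by_cases hMN : M = N
  · subst hMN
    exact hN.ne₁₂ gate_gate.symm
  have hMN' := Subtype.coe_injective.ne hMN
  have hq := (hP.gate_eq_or M.2 N.2 hMN' (G.isGate M p) (G.isGate N p) (G.gate N p).2
    (G.isGate M _) (G.gate M p).2 (G.isGate N _)).resolve_right (Subtype.coe_injective.ne hN.ne₁₂)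
  have hq' := (hP.gate_eq_or M.2 N.2 hMN' (G.isGate M q) (G.isGate N q) (G.gate N p).2
    (G.isGate M _) (G.gate M p).2 (G.isGate N _)).resolve_right
      (Subtype.coe_injective.ne hN.ne₂₃.symm)
  exact hne (Subtype.ext (hq.trans hq'.symm))

theorem eq_of_separates (hM : G.Separates M p q r) (hN : G.Separates N p q r) : M = N :=
  Subtype.ext <| hP.piece_unique M.2 N.2 (G.isGate M p) (G.isGate M q) (G.isGate M r)
    (G.isGate N p) (G.isGate N q) (G.isGate N r) (Subtype.coe_injective.ne hM.ne₁₂)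
    (Subtype.coe_injective.ne hM.ne₁₃) (Subtype.coe_injective.ne hM.ne₂₃)
    (Subtype.coe_injective.ne hN.ne₁₂) (Subtype.coe_injective.ne hN.ne₁₃)
    (Subtype.coe_injective.ne hN.ne₂₃)

omit hP in
theorem eq_center_of_gate_eq {u v : X} (hu : u ∈ (M : Set X)) (hv : v ∈ (M : Set X))
    (h : dist p q = dist p u + dist u v + dist v q) (hpq : G.gate M p = G.gate M q) : u = v := by
  have hp := (G.isGate M p).dist_eq u hu
  have hq := (G.isGate M q).dist_eq v hv
  rw [← hpq] at hq
  refine dist_le_zero.1 ?_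
  linarith [dist_triangle_right p q (G.gate M p), dist_comm q v,
    dist_nonneg (x := (G.gate M p : X)) (y := u), dist_nonneg (x := (G.gate M p : X)) (y := v)]

theorem exists_isMedian (h : ∀ M, ¬ G.Separates M p q r) : ∃ m, IsMedian p q r m := by
  obtain ⟨M, hM, u, hu, v, hv, w, hw, hpq, hpr, hqr⟩ := hP.exists_center p q r
  lift M to P using hM
  have hcases : u = v ∨ v = w ∨ u = w := by
    by_contra! hne
    exact h M ⟨fun h => hne.1 (eq_center_of_gate_eq hu hv hpq h),
      fun h => hne.2.1 (eq_center_of_gate_eq hv hw hqr h),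
      fun h => hne.2.2 (eq_center_of_gate_eq hu hw hpr h)⟩
  rcases hcases with rfl | rfl | rfl
  · refine ⟨u, by rwa [dist_self, add_zero] at hpq, ?_, ?_⟩ <;>
      linarith [dist_triangle u w r, dist_triangle p u r, dist_triangle q u r]
  · refine ⟨v, ?_, by rwa [dist_self, add_zero] at hqr, ?_⟩ <;>
      linarith [dist_triangle p u v, dist_triangle p v q, dist_triangle p v r, dist_comm q v]
  · refine ⟨u, ?_, ?_, by rwa [dist_self, add_zero] at hpr⟩ <;>
      linarith [dist_triangle u v q, dist_triangle p u q, dist_triangle q u r, dist_triangle q v u,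
        dist_comm q u, dist_comm u v, dist_comm q v]

theorem not_separates_median (hm : IsMedian p q r m) (h : ∀ M, ¬ G.Separates M p q r) (M : P) :
    ¬ G.Separates M p m q := fun hM => by
  by_cases hpr : G.gate M p = G.gate M r
  · exact hM.ne₁₂ (gate_eq_of_between hP hm.dist₁₃ hpr).symm
  by_cases hqr : G.gate M q = G.gate M r
  · exact hM.ne₂₃ (gate_eq_of_between hP hm.dist₂₃ hqr)
  · exact h M ⟨hM.ne₁₃, hqr, hpr⟩

theorem geod_eq_left (h : dist p q = dist p m + dist m q) (hsep : ∀ M, ¬ G.Separates M p m q)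
    {s : ℝ} (hs : s ∈ Icc 0 (dist p m)) : G.geod p q s = G.geod p m s := by
  -- Two geodesics can only differ inside a piece `N` which both traverse, and there both of them
  -- run along the chosen geodesic between the gates.
  by_contra hne
  have hk := (G.isGeod p m).concat (G.isGeod m q) h
  set k : ℝ → X := fun r => if r ≤ dist p m then G.geod p m r else G.geod m q (r - dist p m)
  have hks : k s = G.geod p m s := if_pos hs.2
  obtain ⟨N, hN, hpassage⟩ := hP.exists_passage_of_ne (G.isGeod p q) hk (s := s)
    ⟨hs.1, by linarith [hs.2, dist_nonneg (x := m) (y := q)]⟩ (by rwa [hks])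
  lift N to P using hN
  have hsN : s ∈ passage G.gate N p q := hpassage _ _ (G.isGate N p) (G.isGate N q)
  have hpq := hP.dist_of_mem_passage G.isGate hsN
  have hne_pq : G.gate N p ≠ G.gate N q := Subtype.coe_ne_coe.1 (gate_ne_of_mem_passage hsN)
  by_cases hmq : G.gate N m = G.gate N q
  · have hs' : s - dist p (G.gate N p) ∈ Icc 0 (dist (G.gate N p : X) (G.gate N q)) :=
      ⟨by linarith [hsN.1], by linarith [hsN.2]⟩
    have hq := G.straight N p q hne_pq _ hs'
    rw [← hmq] at hs' hne_pq hq
    have hm := G.straight N p m hne_pq _ hs'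
    rw [add_sub_cancel] at hq hm
    exact hne (hq.trans hm.symm)
  · have hpm : G.gate N p = G.gate N m := by
      by_contra hpm
      exact hsep N ⟨hpm, hmq, hne_pq⟩
    have hmq := dist_gates hP hmq
    rw [← hpm] at hmq
    linarith [hsN.1, hs.2, dist_comm q (G.gate N q), dist_nonneg (x := m) (y := G.gate N p)]

theorem geod_eq_right (h : dist p q = dist p m + dist m q) (hsep : ∀ M, ¬ G.Separates M p m q)
    {s : ℝ} (hs : s ∈ Icc 0 (dist m q)) : G.geod p q (dist p m + s) = G.geod m q s := by
  have hqp : dist q p = dist q m + dist m p := by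
    rw [dist_comm q p, h, dist_comm q m, dist_comm m p, add_comm]
  have hs' : dist m q - s ∈ Icc 0 (dist q m) :=
    ⟨by linarith [hs.2], by linarith [hs.1, dist_comm m q]⟩
  rw [G.symm q p _ ⟨by linarith [hs.1, dist_nonneg (x := p) (y := m)],
      by linarith [hs.2, dist_comm p m, dist_comm m q]⟩,
    show dist q p - (dist p m + s) = dist m q - s by linarith [dist_comm p m, dist_comm m q],
    geod_eq_left hP hqp (fun M hM => hsep M hM.reverse) hs',
    G.symm m q _ ⟨hs'.1, by linarith [hs.1]⟩, sub_sub_cancel]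

end Separation

end StraightGeodesics

namespace StraightGeodesics

section Lines

variable {X : Type*} [MetricSpace X] {P : Set (Set X)} (G : StraightGeodesics P)

/-- The chosen geodesic from `p` to `q`, as a path. -/
def linePath (p q : X) : Path p q where
  toFun t := G.geod p q (t * dist p q)
  continuous_toFun := (G.isGeod p q).continuousOn.comp_continuous (by fun_prop) fun t =>
    ⟨mul_nonneg t.2.1 dist_nonneg, mul_le_of_le_one_left dist_nonneg t.2.2⟩
  source' := by simpa using (G.isGeod p q).map_zero
  target' := by simpa using (G.isGeod p q).map_dist

/-- The chosen geodesic from `p` to `q` stays in `S`. -/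
def LineMem (S : Set X) (p q : X) : Prop :=
  MapsTo (G.geod p q) (Icc 0 (dist p q)) S

variable {G} {S : Set X} {M : P} {p q r m : X}

theorem lineMem_of_mem_piece (hP : IsTreeGrading P) (hp : p ∈ (M : Set X)) (hq : q ∈ (M : Set X)) :
    G.LineMem M p q :=
  hP.geod_mem_piece M.2 hp hq (G.isGeod p q)

theorem lineMem_univ : G.LineMem univ p q := fun _ _ => mem_univ _

namespace LineMem

theorem linePath_mem (h : G.LineMem S p q) (t : I) : G.linePath p q t ∈ S :=
  h ⟨mul_nonneg t.2.1 dist_nonneg, mul_le_of_le_one_left dist_nonneg t.2.2⟩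

theorem left_mem (h : G.LineMem S p q) : p ∈ S := by
  simpa using h.linePath_mem 0

theorem right_mem (h : G.LineMem S p q) : q ∈ S := by
  simpa using h.linePath_mem 1

theorem symm (h : G.LineMem S p q) : G.LineMem S q p := fun s hs => by
  rw [dist_comm] at hs
  rw [G.symm p q s hs]
  exact h ⟨sub_nonneg.2 hs.2, sub_le_self _ hs.1⟩

theorem left (hP : IsTreeGrading P) (h : G.LineMem S p q) (hm : dist p q = dist p m + dist m q)
    (hsep : ∀ M, ¬ G.Separates M p m q) : G.LineMem S p m := fun s hs => by
  rw [← geod_eq_left hP hm hsep hs]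
  exact h ⟨hs.1, by linarith [hs.2, dist_nonneg (x := m) (y := q)]⟩

theorem right (hP : IsTreeGrading P) (h : G.LineMem S p q) (hm : dist p q = dist p m + dist m q)
    (hsep : ∀ M, ¬ G.Separates M p m q) : G.LineMem S m q := fun s hs => by
  rw [← geod_eq_right hP hm hsep hs]
  exact h ⟨by linarith [hs.1, dist_nonneg (x := p) (y := m)], by linarith [hs.2]⟩

end LineMem

/-- The homotopy class in `S` of the chosen geodesic from `p` to `q`. -/
def lineIn (h : G.LineMem S p q) : PathClass (⟨p, h.left_mem⟩ : S) ⟨q, h.right_mem⟩ :=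
  .mk (restrictPath (G.linePath p q) h.linePath_mem)

theorem lineIn_self (h : G.LineMem S p p) : lineIn h = .refl _ := by
  refine congrArg Path.Homotopic.Quotient.mk (Path.ext (funext fun t => Subtype.ext ?_))
  change G.geod p p (t * dist p p) = p
  rw [dist_self, mul_zero, (G.isGeod p p).map_zero]

theorem lineIn_symm (h : G.LineMem S p q) : (lineIn h).symm = lineIn h.symm := by
  rw [lineIn, lineIn, ← mk_symm]
  refine congrArg Path.Homotopic.Quotient.mk (Path.ext (funext fun t => Subtype.ext ?_))
  change G.geod p q ((1 - t) * dist p q) = G.geod q p (t * dist q p)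
  rw [dist_comm q p, G.symm p q _ ⟨mul_nonneg t.2.1 dist_nonneg,
    mul_le_of_le_one_left dist_nonneg t.2.2⟩]
  ring_nf

variable (hP : IsTreeGrading P)
include hP

theorem lineIn_trans (h : G.LineMem S p q) (hpm : G.LineMem S p m) (hmq : G.LineMem S m q)
    (hm : dist p q = dist p m + dist m q) (hsep : ∀ M, ¬ G.Separates M p m q) :
    (lineIn hpm).trans (lineIn hmq) = lineIn h := by
  have hd : (0 : ℝ) ≤ dist p q := dist_nonneg
  let f : C(ℝ, S) := ⟨fun s => ⟨G.geod p q (projIcc 0 (dist p q) hd s),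
    h (projIcc 0 (dist p q) hd s).2⟩, (G.isGeod p q).continuous_clamp.subtype_mk _⟩
  have hf {s : ℝ} (hs : s ∈ Icc 0 (dist p q)) : (f s : X) = G.geod p q s := by
    simp only [f, ContinuousMap.coe_mk, projIcc_of_mem hd hs]
  have hmul (t : I) {d : ℝ} (hd : 0 ≤ d) : t * d ∈ Icc 0 d :=
    ⟨mul_nonneg t.2.1 hd, mul_le_of_le_one_left hd t.2.2⟩
  refine PathClass.mk_trans_mk_of_simplyConnected f (Path.segment 0 (dist p m))
    (Path.segment (dist p m) (dist p q)) (Path.segment 0 (dist p q))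
    (fun t => Subtype.ext ?_) (fun t => Subtype.ext ?_) (fun t => Subtype.ext ?_)
  · have ht := hmul t (dist_nonneg (x := p) (y := m))
    simp only [Path.segment_apply, AffineMap.lineMap_apply_ring', sub_zero, add_zero]
    rw [hf ⟨ht.1, by linarith [ht.2, dist_nonneg (x := m) (y := q)]⟩, geod_eq_left hP hm hsep ht]
    rfl
  · have ht := hmul t (dist_nonneg (x := m) (y := q))
    simp only [Path.segment_apply, AffineMap.lineMap_apply_ring', hm, add_sub_cancel_left]
    rw [add_comm, hf ⟨by linarith [ht.1, dist_nonneg (x := p) (y := m)], by linarith [ht.2]⟩,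
      geod_eq_right hP hm hsep ht]
    rfl
  · simp only [Path.segment_apply, AffineMap.lineMap_apply_ring', sub_zero, add_zero]
    rw [hf (hmul t hd)]
    rfl

theorem dist_gate_left (hne : G.gate M p ≠ G.gate M q) :
    dist p q = dist p (G.gate M p) + dist (G.gate M p : X) q := by
  have h := dist_gates hP hne
  linarith [dist_triangle p (G.gate M p) q, dist_triangle (G.gate M p : X) (G.gate M q) q]

theorem LineMem.gate_right (h : G.LineMem S p q) (hne : G.gate M p ≠ G.gate M q) :
    G.LineMem S (G.gate M p) q :=
  h.right hP (dist_gate_left hP hne) fun _ => not_separates_gate hP hne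

theorem LineMem.left_gate (h : G.LineMem S p q) (hne : G.gate M p ≠ G.gate M q) :
    G.LineMem S p (G.gate M p) :=
  h.left hP (dist_gate_left hP hne) fun _ => not_separates_gate hP hne

theorem LineMem.gate_left (h : G.LineMem S p q) (hne : G.gate M p ≠ G.gate M q) :
    G.LineMem S (G.gate M q) q :=
  (h.symm.left_gate hP hne.symm).symm

theorem LineMem.gates (h : G.LineMem S p q) (hne : G.gate M p ≠ G.gate M q) :
    G.LineMem S (G.gate M p) (G.gate M q) :=
  ((h.symm.gate_right hP hne.symm).symm).gate_right hP (by rwa [gate_gate])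

theorem lineIn_gates (h : G.LineMem S p q) (hne : G.gate M p ≠ G.gate M q) :
    (lineIn (h.left_gate hP hne)).trans ((lineIn (h.gates hP hne)).trans
      (lineIn (h.gate_left hP hne))) = lineIn h := by
  have hne' : G.gate M q ≠ G.gate M (G.gate M p) := by rwa [gate_gate, ne_comm]
  have hd : dist (G.gate M p : X) q =
      dist (G.gate M p : X) (G.gate M q) + dist (G.gate M q : X) q := by
    linarith [dist_gate_left hP hne', dist_comm (G.gate M p : X) q, dist_comm q (G.gate M q),
      dist_comm (G.gate M q : X) (G.gate M p)]
  rw [lineIn_trans hP (h.gate_right hP hne) _ _ hd fun N hN =>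
    not_separates_gate hP hne' hN.reverse]
  exact lineIn_trans hP h _ _ (dist_gate_left hP hne) fun _ => not_separates_gate hP hne

theorem lineIn_triangle (hpq : G.LineMem S p q) (hqr : G.LineMem S q r) (hpr : G.LineMem S p r)
    (hsep : ∀ M, ¬ G.Separates M p q r) :
    (lineIn hpq).trans (lineIn hqr) = lineIn hpr := by
  obtain ⟨m, hm⟩ := exists_isMedian hP hsep
  have h₁₂ := not_separates_median hP hm hsep
  have h₂₃ := not_separates_median hP hm.rotate fun M hM => hsep M hM.rotate.rotate
  have h₁₃ := not_separates_median hP hm.swap fun M hM => hsep M hM.reverse.rotate.rotate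
  have hpm := hpq.left hP hm.dist₁₂ h₁₂
  have hmq := hpq.right hP hm.dist₁₂ h₁₂
  have hmr := hqr.right hP hm.dist₂₃ h₂₃
  rw [← lineIn_trans hP hpq hpm hmq hm.dist₁₂ h₁₂,
    ← lineIn_trans hP hqr hmq.symm hmr hm.dist₂₃ h₂₃,
    ← lineIn_trans hP hpr hpm hmr hm.dist₁₃ h₁₃, trans_assoc, ← lineIn_symm hmq,
    PathClass.trans_symm_cancel]

omit hP

variable (G) in
/-- The homotopy class of the chosen geodesic from `p` to `q`. -/
def line (p q : X) : PathClass p q := .mk (G.linePath p q)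

theorem line_self : G.line p p = .refl p :=
  congrArg (Path.Homotopic.Quotient.map · (subtypeVal univ)) (lineIn_self lineMem_univ)

theorem line_symm : (G.line p q).symm = G.line q p :=
  congrArg (Path.Homotopic.Quotient.map · (subtypeVal univ)) (lineIn_symm lineMem_univ)

include hP

theorem line_trans (hm : dist p q = dist p m + dist m q) (hsep : ∀ M, ¬ G.Separates M p m q) :
    (G.line p m).trans (G.line m q) = G.line p q :=
  (PathClass.map_trans _ _ _).symm.trans <|
    congrArg (Path.Homotopic.Quotient.map · (subtypeVal univ)) <|
      lineIn_trans hP lineMem_univ lineMem_univ lineMem_univ hm hsep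

theorem line_triangle (hsep : ∀ M, ¬ G.Separates M p q r) :
    (G.line p q).trans (G.line q r) = G.line p r :=
  (PathClass.map_trans _ _ _).symm.trans <|
    congrArg (Path.Homotopic.Quotient.map · (subtypeVal univ)) <|
      lineIn_triangle hP lineMem_univ lineMem_univ lineMem_univ hsep

theorem line_gates (hne : G.gate M p ≠ G.gate M q) :
    (G.line p (G.gate M p)).trans ((G.line (G.gate M p) (G.gate M q)).trans
      (G.line (G.gate M q) q)) = G.line p q := by
  have h := congrArg (Path.Homotopic.Quotient.map · (subtypeVal univ))
    (lineIn_gates hP lineMem_univ hne)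
  rw [PathClass.map_trans, PathClass.map_trans] at h
  exact h

end Lines

end StraightGeodesics

section SimpleConnectivity

variable {X Y Z : Type*} [TopologicalSpace X] [TopologicalSpace Y] [TopologicalSpace Z]
  {S T U : Set X}

/-- `S ⊆ T`, and paths in `S` with common end points are homotopic in `T`. -/
def PathsHomotopicIn (S T : Set X) : Prop :=
  ∃ h : S ⊆ T, ∀ (a b : S) (C D : PathClass a b),
    C.map (ContinuousMap.inclusion h) = D.map (ContinuousMap.inclusion h)

theorem PathsHomotopicIn.mono (h : PathsHomotopicIn S T) (hTU : T ⊆ U) :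
    PathsHomotopicIn S U := by
  obtain ⟨hST, h⟩ := h
  refine ⟨hST.trans hTU, fun a b C D => ?_⟩
  have hCD := congrArg (Path.Homotopic.Quotient.map · (ContinuousMap.inclusion hTU)) (h a b C D)
  rw [← map_comp, ← map_comp] at hCD
  exact hCD

theorem PathClass.map_eq_of_nullhomotopic {f : C(Y, Z)} (hf : f.Nullhomotopic) {a b : Y}
    (C D : PathClass a b) : C.map f = D.map f := by
  obtain ⟨z, ⟨H⟩⟩ := hf
  induction C using Path.Homotopic.Quotient.ind with | mk p =>
  induction D using Path.Homotopic.Quotient.ind with | mk q =>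
  have hH (p : Path a b) : ((mk p).map f).trans (mk (H.evalAt b)) = mk (H.evalAt a) := by
    rw [← mk_map, ← mk_trans, Path.Homotopic.Quotient.eq.2 (Path.Homotopic.map_trans_evalAt H p),
      mk_trans]
    exact trans_refl _
  rw [← trans_refl ((mk p).map f), ← trans_symm (mk (H.evalAt b)), ← trans_assoc, hH, ← hH q,
    trans_assoc, trans_symm, trans_refl]

end SimpleConnectivity

/-- Every piece is locally simply connected, uniformly over all pieces and all of their points. -/
def LocallyUniformlySimplyConnected {X : Type*} [MetricSpace X] (P : Set (Set X)) : Prop :=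
  ∀ ε : ℝ, 0 < ε → ∃ δ : ℝ, 0 < δ ∧ ∀ M ∈ P, ∀ y ∈ M,
    PathsHomotopicIn (M ∩ Metric.ball y δ) (M ∩ Metric.ball y ε)

theorem LocallyUniformlyContractible.locallyUniformlySimplyConnected {X : Type*} [MetricSpace X]
    {P : Set (Set X)} (h : LocallyUniformlyContractible fun M : P => (M : Set X)) :
    LocallyUniformlySimplyConnected P := fun ε hε => by
  obtain ⟨δ, hδ, hle, hnull⟩ := h ε hε
  refine ⟨δ, hδ, fun M hM y hy => ⟨inter_subset_inter_right M (Metric.ball_subset_ball hle),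
    fun a b => PathClass.map_eq_of_nullhomotopic ?_⟩⟩
  let f : C(↥(M ∩ Metric.ball y δ), Metric.ball (⟨y, hy⟩ : M) δ) :=
    ⟨fun a => ⟨⟨a, a.2.1⟩, a.2.2⟩, by fun_prop⟩
  let g : C(Metric.ball (⟨y, hy⟩ : M) ε, ↥(M ∩ Metric.ball y ε)) :=
    ⟨fun a => ⟨a, a.1.2, a.2⟩, by fun_prop⟩
  exact ((hnull ⟨M, hM⟩ ⟨y, hy⟩).comp_right g).comp_left f

namespace StraightGeodesics

section SmallTriangles

variable {X : Type*} [MetricSpace X] {P : Set (Set X)} {G : StraightGeodesics P} {S : Set X} {M : P}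
  {p q r o : X}

theorem lineMem_ball {ε : ℝ} (h : dist p o + dist p q < ε) : G.LineMem (Metric.ball o ε) p q :=
  fun s hs => by
    have hd := (G.isGeod p q).dist_left hs
    refine Metric.mem_ball.2 ?_
    linarith [dist_triangle_left (G.geod p q s) o p, hs.2]

variable (hP : IsTreeGrading P)
include hP

theorem lineIn_triangle_of_mem_piece {δ : ℝ} (hS : PathsHomotopicIn (↑M ∩ Metric.ball p δ) S)
    (hp : p ∈ (M : Set X)) (hq : q ∈ (M : Set X)) (hr : r ∈ (M : Set X))
    (hpq : G.LineMem S p q) (hqr : G.LineMem S q r) (hpr : G.LineMem S p r)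
    (hd₁ : dist p q < δ / 2) (hd₂ : dist q r < δ / 2) :
    (lineIn hpq).trans (lineIn hqr) = lineIn hpr := by
  have hmem {a b : X} (ha : a ∈ (M : Set X)) (hb : b ∈ (M : Set X)) (hd : dist a p + dist a b < δ) :
      G.LineMem (↑M ∩ Metric.ball p δ) a b := fun s hs =>
    ⟨lineMem_of_mem_piece hP ha hb hs, lineMem_ball hd hs⟩
  have hpq' := hmem hp hq (by linarith [dist_self p, dist_nonneg (x := p) (y := q)])
  have hqr' := hmem hq hr (by linarith [dist_comm q p])
  have hpr' := hmem hp hr (by linarith [dist_self p, dist_triangle p q r])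
  obtain ⟨_, hS⟩ := hS
  have h := hS _ _ ((lineIn hpq').trans (lineIn hqr')) (lineIn hpr')
  rw [PathClass.map_trans] at h
  exact h

theorem exists_lineIn_triangle (hsc : LocallyUniformlySimplyConnected P) {ε : ℝ} (hε : 0 < ε) :
    ∃ δ > 0, ∀ o p q r, dist o p < δ → dist o q < δ → dist o r < δ →
      ∃ (hpq : G.LineMem (Metric.ball o ε) p q) (hqr : G.LineMem (Metric.ball o ε) q r)
        (hpr : G.LineMem (Metric.ball o ε) p r), (lineIn hpq).trans (lineIn hqr) = lineIn hpr := by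
  obtain ⟨η, hη₀, hη⟩ := hsc (ε / 2) (half_pos hε)
  refine ⟨min (η / 4) (ε / 6), by positivity, fun o p q r hp hq hr => ?_⟩
  obtain ⟨hp₁, hp₂⟩ := lt_min_iff.1 hp
  obtain ⟨hq₁, hq₂⟩ := lt_min_iff.1 hq
  obtain ⟨hr₁, hr₂⟩ := lt_min_iff.1 hr
  have hdpq := dist_triangle_left p q o
  have hdqr := dist_triangle_left q r o
  have hdpr := dist_triangle_left p r o
  have hpo := dist_comm p o
  have hqo := dist_comm q o
  have hpq : G.LineMem (Metric.ball o ε) p q := lineMem_ball (by linarith)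
  have hqr : G.LineMem (Metric.ball o ε) q r := lineMem_ball (by linarith)
  have hpr : G.LineMem (Metric.ball o ε) p r := lineMem_ball (by linarith)
  refine ⟨hpq, hqr, hpr, ?_⟩
  by_cases hsep : ∃ M, G.Separates M p q r
  swap
  · exact lineIn_triangle hP hpq hqr hpr (not_exists.1 hsep)
  obtain ⟨M, h₁₂, h₂₃, h₁₃⟩ := hsep
  have hgates : (lineIn (hpq.gates hP h₁₂)).trans (lineIn (hqr.gates hP h₂₃)) =
      lineIn (hpr.gates hP h₁₃) := by
    refine lineIn_triangle_of_mem_piece hP ((hη M M.2 _ (G.gate M p).2).mono fun z hz => ?_)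
      (G.gate M p).2 (G.gate M q).2 (G.gate M r).2 _ _ _ ?_ ?_
    · have := dist_gate_left hP h₁₂
      have hz := Metric.mem_ball.1 hz.2
      refine Metric.mem_ball.2 ?_
      linarith [dist_triangle z (G.gate M p) o, dist_triangle_left (G.gate M p : X) o p,
        dist_nonneg (x := (G.gate M p : X)) (y := q)]
    · exact (dist_gate_le hP).trans_lt (by linarith)
    · exact (dist_gate_le hP).trans_lt (by linarith)
  rw [← lineIn_gates hP hpq h₁₂, ← lineIn_gates hP hqr h₂₃, ← lineIn_gates hP hpr h₁₃, ← hgates,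
    trans_assoc, trans_assoc, trans_assoc, ← lineIn_symm (hqr.left_gate hP h₂₃),
    PathClass.symm_trans_cancel]

end SmallTriangles

end StraightGeodesics

section InfiniteConcatenation

variable {Z : Type*} [TopologicalSpace Z] {z : ℕ → Z} {w : Z}

theorem exists_concat (γ : ∀ n, Path (z n) (z (n + 1))) :
    ∃ g : ℝ → Z, Continuous g ∧ g 0 = z 0 ∧ ∀ t, g t ∈ range (γ ⌊t⌋₊) := by
  refine ⟨fun t => (γ ⌊t⌋₊).extend (t - ⌊t⌋₊), ?_, by simp, fun t => mem_range_self _⟩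
  have hfloor {t : ℝ} {n : ℕ} (h : ⌊t⌋₊ = n) :
      (γ ⌊t⌋₊).extend (t - ⌊t⌋₊) = (γ n).extend (t - n) := by
    subst h
    rfl
  have hIic (n : ℕ) : ContinuousOn (fun t : ℝ => (γ ⌊t⌋₊).extend (t - ⌊t⌋₊)) (Iic n) := by
    induction n with
    | zero =>
      refine (continuousOn_const (c := z 0)).congr fun t (ht : t ≤ (0 : ℕ)) => ?_
      rw [Nat.cast_zero] at ht
      exact (hfloor (Nat.floor_of_nonpos ht)).trans
        ((γ 0).extend_of_le_zero (by rwa [Nat.cast_zero, sub_zero]))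
    | succ n ih =>
      have hle : (n : ℝ) ≤ (n + 1 : ℕ) := Nat.cast_le.2 n.le_succ
      rw [← Iic_union_Icc_eq_Iic hle]
      refine ih.union_of_isClosed ?_ isClosed_Iic isClosed_Icc
      refine ((γ n).continuous_extend.comp (continuous_sub_right (n : ℝ))).continuousOn.congr
        fun t ht => ?_
      rcases ht.2.eq_or_lt with rfl | hlt
      · refine (hfloor (Nat.floor_natCast (n + 1))).trans ?_
        simp
      · exact hfloor (Nat.floor_eq_on_Ico n t ⟨ht.1, by exact_mod_cast hlt⟩)
  refine continuous_iff_continuousAt.2 fun t => (hIic (⌊t⌋₊ + 1)).continuousAt (Iic_mem_nhds ?_)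
  exact_mod_cast Nat.lt_floor_add_one t

theorem joined_of_paths_tendsto (γ : ∀ n, Path (z n) (z (n + 1)))
    (hw : ∀ U ∈ 𝓝 w, ∀ᶠ n in atTop, range (γ n) ⊆ U) : Joined w (z 0) := by
  obtain ⟨g, hg, hg0, hrange⟩ := exists_concat γ
  let f (t : ℝ) : Z := if t ≤ 0 then w else g (t⁻¹ - 1)
  have hf : Continuous f := continuous_iff_continuousAt.2 fun t => by
    rcases le_or_gt t 0 with ht | ht
    · rw [ContinuousAt, show f t = w from if_pos ht]
      intro U hU
      obtain ⟨N, hN⟩ := eventually_atTop.1 (hw U hU)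
      refine mem_map.2 ?_
      filter_upwards [Iio_mem_nhds (ht.trans_lt (Nat.one_div_pos_of_nat (n := N)))] with s hs
      rw [mem_preimage]
      by_cases hs₀ : s ≤ 0
      · simpa only [f, if_pos hs₀] using mem_of_mem_nhds hU
      · simp only [f, if_neg hs₀]
        refine hN _ (Nat.le_floor ?_) (hrange _)
        have hinv : (N + 1 : ℝ) < s⁻¹ :=
          (lt_inv_comm₀ (not_le.1 hs₀) N.cast_add_one_pos).1 (by simpa using hs)
        linarith
    · refine ContinuousAt.congr ?_ ((lt_mem_nhds ht).mono fun s hs => (if_neg (not_le.2 hs)).symm)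
      exact hg.continuousAt.comp ((continuousAt_inv₀ ht.ne').sub continuousAt_const)
  have h : Joined (f 0) (f 1) := ⟨(Path.segment (0 : ℝ) 1).map hf⟩
  simpa [f, hg0, zero_lt_one.not_ge] using h

theorem joined_of_eventually_joinedIn [FirstCountableTopology Z]
    (hjoined : ∀ n, Joined (z n) (z (n + 1)))
    (hw : ∀ U ∈ 𝓝 w, ∀ᶠ n in atTop, JoinedIn U (z n) (z (n + 1))) : Joined w (z 0) := by
  obtain ⟨U, hU⟩ := (𝓝 w).exists_antitone_basis
  obtain ⟨φ, hφ, hjoin⟩ := extraction_forall_of_eventually fun k =>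
    eventually_forall_ge_atTop.2 (hw (U k) (hU.mem k))
  have hchain {k n : ℕ} (hn : φ k ≤ n) : JoinedIn (U k) (z (φ k)) (z n) := by
    induction n, hn using Nat.le_induction with
    | base => exact .refl (hjoin k _ le_rfl).source_mem
    | succ n hn ih => exact ih.trans (hjoin k n hn)
  have hstart (n : ℕ) : Joined (z n) (z 0) := by
    induction n with
    | zero => rfl
    | succ n ih => exact (hjoined n).symm.trans ih
  choose γ hγ using fun k : ℕ => hchain (hφ.monotone k.le_succ)
  refine (joined_of_paths_tendsto γ fun V hV => ?_).trans (hstart _)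
  obtain ⟨k, hk⟩ := hU.mem_iff.1 hV
  filter_upwards [eventually_ge_atTop k] with n hn
  exact range_subset_iff.2 fun t => hk (hU.antitone hn (hγ n t))

end InfiniteConcatenation

section PathSpace

variable {X : Type*} [TopologicalSpace X] {a b c : X}

theorem PathClass.mk_eq_of_joined {p q : Path a b} (h : Joined p q) : mk p = mk q := by
  obtain ⟨Γ⟩ := h
  have hΓ : Continuous fun s : I × I => Γ s.1 s.2 := Path.continuous_uncurry_iff.2 Γ.continuous
  refine Path.Homotopic.Quotient.eq.2 ⟨⟨⟨⟨_, hΓ⟩, fun t => ?_, fun t => ?_⟩, fun s t ht => ?_⟩⟩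
  · simp
  · simp
  · rcases ht with rfl | rfl <;> simp

theorem mk_restrictPath_trans {S : Set X} {a b c : S} {p : Path (a : X) b} {q : Path (b : X) c}
    (hp : ∀ t, p t ∈ S) (hq : ∀ t, q t ∈ S) (hpq : ∀ t, p.trans q t ∈ S) :
    (mk (restrictPath p hp)).trans (mk (restrictPath q hq)) =
      mk (restrictPath (p.trans q) hpq) := by
  rw [← mk_trans]
  refine congrArg mk (Path.ext (funext fun t => Subtype.ext ?_))
  refine Eq.trans ?_ (Path.trans_apply p q t).symm
  rw [Path.trans_apply]
  split_ifs <;> rfl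

theorem joinedIn_of_mk_restrictPath_eq {S : Set X} {a b : S} {p q : Path (a : X) b}
    {hp : ∀ t, p t ∈ S} {hq : ∀ t, q t ∈ S} (h : mk (restrictPath p hp) = mk (restrictPath q hq)) :
    JoinedIn {r : Path (a : X) b | ∀ t, r t ∈ S} p q := by
  obtain ⟨H⟩ := Path.Homotopic.Quotient.eq.1 h
  have hcont : Continuous fun s : I => (H.eval s).map continuous_subtype_val :=
    Path.continuous_uncurry_iff.1 (continuous_subtype_val.comp H.continuous)
  refine ⟨⟨⟨_, hcont⟩, ?_, ?_⟩, fun s t => (H.eval s t).2⟩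
  · ext t
    exact congrArg Subtype.val (H.map_zero_left t)
  · ext t
    exact congrArg Subtype.val (H.map_one_left t)

theorem joinedIn_path_trans {S : Set (Path a b)} {T : Set (Path b c)} {U : Set (Path a c)}
    {p p' : Path a b} {q q' : Path b c} (hp : JoinedIn S p p') (hq : JoinedIn T q q')
    (hU : ∀ r ∈ S, ∀ s ∈ T, r.trans s ∈ U) : JoinedIn U (p.trans q) (p'.trans q') :=
  ((hp.prod hq).map Path.continuous_trans).mono <| by
    rintro _ ⟨⟨r, s⟩, ⟨hr, hs⟩, rfl⟩
    exact hU r hr s hs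

/-- The midpoint of the parameter interval of a path. -/
noncomputable abbrev midTime : I :=
  ⟨1 / 2, unitInterval.div_mem zero_le_one zero_le_two one_le_two⟩

/-- The restriction of a path to the first half of its parameter interval. -/
noncomputable def firstHalf (p : Path a b) : Path a (p midTime) where
  toFun t := p ⟨t / 2, unitInterval.div_mem t.2.1 zero_le_two (t.2.2.trans one_le_two)⟩
  source' := by simp
  target' := rfl

/-- The restriction of a path to the second half of its parameter interval. -/
noncomputable def secondHalf (p : Path a b) : Path (p midTime) b where
  toFun t := p ⟨(t + 1) / 2, unitInterval.div_mem (add_nonneg t.2.1 zero_le_one) zero_le_two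
    (by linarith [t.2.2])⟩
  source' := congrArg p (Subtype.ext (by simp))
  target' := by simp

theorem firstHalf_trans_secondHalf (p : Path a b) : (firstHalf p).trans (secondHalf p) = p := by
  ext t
  rw [Path.trans_apply]
  split_ifs <;> exact congrArg p (Subtype.ext (by simp))

end PathSpace

section FinePaths

variable {X : Type*} [MetricSpace X] {a b c : X} {δ ε : ℝ} {n : ℕ}

/-- The image of `p` has diameter less than `δ`, in the weak sense that any two of its points are
at distance less than `δ`. -/
def IsSmall (δ : ℝ) (p : Path a b) : Prop := ∀ s t, dist (p s) (p t) < δ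

/-- Bisecting `p` repeatedly, `n` times, cuts it into `2 ^ n` pieces which are `δ`-small. -/
def IsFine (δ : ℝ) : ℕ → ∀ {a b : X}, Path a b → Prop
  | 0, _, _, p => IsSmall δ p
  | n + 1, _, _, p => IsFine δ n (firstHalf p) ∧ IsFine δ n (secondHalf p)

theorem isFine_of_forall_dist_lt {p : Path a b}
    (h : ∀ s t, dist s t ≤ (1 / 2) ^ n → dist (p s) (p t) < δ) : IsFine δ n p := by
  induction n generalizing a b with
  | zero => exact fun s t => h s t ((Real.dist_le_of_mem_Icc_01 s.2 t.2).trans_eq (by simp))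
  | succ n ih =>
    refine ⟨ih fun s t hst => h _ _ ?_, ih fun s t hst => h _ _ ?_⟩
    all_goals
      rw [Subtype.dist_eq, Real.dist_eq] at hst ⊢
      rw [← sub_div, abs_div, abs_two, div_le_iff₀ two_pos, pow_succ]
      simpa using hst

theorem eventually_isFine (hδ : 0 < δ) (p : Path a b) : ∀ᶠ n in atTop, IsFine δ n p := by
  obtain ⟨η, hη, h⟩ := Metric.uniformContinuous_iff.1
    (CompactSpace.uniformContinuous_of_continuous p.continuous) δ hδ
  have hlim := tendsto_pow_atTop_nhds_zero_of_lt_one (r := (1 / 2 : ℝ)) (by norm_num) (by norm_num)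
  filter_upwards [hlim.eventually_lt_const hη] with n hn
  exact isFine_of_forall_dist_lt fun s t hst => h (hst.trans_lt hn)

theorem IsSmall.isFine {p : Path a b} (h : IsSmall δ p) : IsFine δ n p :=
  isFine_of_forall_dist_lt fun s t _ => h s t

/-- The paths which stay uniformly at distance less than `ε` from `p`. -/
def nearPaths (p : Path a b) (ε : ℝ) : Set (Path a b) := {q | ∀ t, dist (q t) (p t) < ε}

theorem nearPaths_mem_nhds (p : Path a b) (hε : 0 < ε) : nearPaths p ε ∈ 𝓝 p :=
  (mem_nhds_induced _ _ _).2 ⟨_, Metric.ball_mem_nhds (p : C(I, X)) hε, fun _ hq t =>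
    (ContinuousMap.dist_lt_iff hε).1 hq t⟩

theorem exists_nearPaths_subset {p : Path a b} {U : Set (Path a b)} (hU : U ∈ 𝓝 p) :
    ∃ ε > 0, nearPaths p ε ⊆ U := by
  obtain ⟨V, hV, hVU⟩ := (mem_nhds_induced _ _ _).1 hU
  obtain ⟨ε, hε, hball⟩ := Metric.mem_nhds_iff.1 hV
  exact ⟨ε, hε, fun q hq => hVU (hball (ContinuousMap.dist_lt_of_nonempty hq))⟩

theorem trans_mem_nearPaths {p r : Path a b} {q s : Path b c} (hr : r ∈ nearPaths p ε)
    (hs : s ∈ nearPaths q ε) : r.trans s ∈ nearPaths (p.trans q) ε := fun t => by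
  rw [Path.trans_apply, Path.trans_apply]
  split_ifs
  · exact hr _
  · exact hs _

end FinePaths

namespace StraightGeodesics

variable {X : Type*} [MetricSpace X] {P : Set (Set X)} {G : StraightGeodesics P} {a b : X}

theorem isSmall_linePath {δ : ℝ} (h : dist a b < δ) : IsSmall δ (G.linePath a b) := fun s t => by
  refine ((G.isGeod a b).isGeodesicOn _ ?_ _ ?_).trans_lt ?_
  · exact ⟨mul_nonneg s.2.1 dist_nonneg, mul_le_of_le_one_left dist_nonneg s.2.2⟩
  · exact ⟨mul_nonneg t.2.1 dist_nonneg, mul_le_of_le_one_left dist_nonneg t.2.2⟩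
  · rw [← sub_mul, abs_mul, abs_of_nonneg (dist_nonneg (x := a))]
    refine (mul_le_of_le_one_left dist_nonneg ?_).trans_lt h
    exact Real.dist_le_of_mem_Icc_01 s.2 t.2 |>.trans_eq (by norm_num)

variable (G) in
/-- The concatenation of the `2 ^ n` straight geodesics between consecutive points in the `n`-th
dyadic subdivision of a path. -/
noncomputable def inscribed : ℕ → ∀ {a b : X}, Path a b → Path a b
  | 0, a, b, _ => G.linePath a b
  | n + 1, _, _, p => (inscribed n (firstHalf p)).trans (inscribed n (secondHalf p))

variable (hP : IsTreeGrading P) (hsc : LocallyUniformlySimplyConnected P)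
include hP hsc

theorem exists_joinedIn_inscribed_one {ε : ℝ} (hε : 0 < ε) :
    ∃ δ > 0, ∀ {a b : X} (p : Path a b), IsSmall δ p →
      JoinedIn (nearPaths p ε) (G.inscribed 0 p) (G.inscribed 1 p) := by
  obtain ⟨δ, hδ, htriangle⟩ := exists_lineIn_triangle (G := G) hP hsc (half_pos hε)
  refine ⟨min δ (ε / 2), by positivity, fun {a b} p hp => ?_⟩
  have hnear (t : I) : dist a (p t) < min δ (ε / 2) := by simpa using hp 0 t
  obtain ⟨h₁, h₂, h, heq⟩ := htriangle a a (p midTime) b (by simpa using hδ)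
    ((hnear _).trans_le (min_le_left _ _)) (by simpa using (hnear 1).trans_le (min_le_left _ _))
  have hmem (t : I) : (G.linePath a (p midTime)).trans (G.linePath (p midTime) b) t ∈
      Metric.ball a (ε / 2) := by
    rw [Path.trans_apply]
    split_ifs
    exacts [h₁.linePath_mem _, h₂.linePath_mem _]
  have hjoined := joinedIn_of_mk_restrictPath_eq
    (heq.symm.trans (mk_restrictPath_trans h₁.linePath_mem h₂.linePath_mem hmem))
  refine hjoined.mono fun r hr t => ?_
  have hrt := Metric.mem_ball.1 (hr t)
  have hpt := (hnear t).trans_le (min_le_right _ _)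
  exact (dist_triangle _ a _).trans_lt (by linarith)

theorem exists_joinedIn_inscribed {ε : ℝ} (hε : 0 < ε) :
    ∃ δ > 0, ∀ (n : ℕ) {a b : X} (p : Path a b), IsFine δ n p →
      JoinedIn (nearPaths p ε) (G.inscribed n p) (G.inscribed (n + 1) p) := by
  obtain ⟨δ, hδ, hjoin⟩ := exists_joinedIn_inscribed_one (G := G) hP hsc hε
  refine ⟨δ, hδ, fun n => ?_⟩
  induction n with
  | zero => exact hjoin
  | succ n ih =>
    intro a b p hp
    refine joinedIn_path_trans (ih _ hp.1) (ih _ hp.2) fun r hr s hs => ?_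
    have hrs := trans_mem_nearPaths hr hs
    rwa [firstHalf_trans_secondHalf] at hrs

theorem exists_mk_eq_line : ∃ δ > 0, ∀ {a b : X} (p : Path a b), IsSmall δ p →
    Path.Homotopic.Quotient.mk p = G.line a b := by
  choose δ hδ hjoin using fun ε : {ε : ℝ // 0 < ε} =>
    exists_joinedIn_inscribed (G := G) hP hsc ε.2
  refine ⟨δ ⟨1, one_pos⟩, hδ _, fun {a b} p hp => PathClass.mk_eq_of_joined ?_⟩
  have : FirstCountableTopology (Path a b) :=
    TopologicalSpace.firstCountableTopology_induced _ C(I, X) _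
  refine joined_of_eventually_joinedIn (z := fun n => G.inscribed n p)
    (fun n => (hjoin _ n p hp.isFine).joined) fun U hU => ?_
  obtain ⟨ε, hε, hεU⟩ := exists_nearPaths_subset hU
  filter_upwards [eventually_isFine (hδ ⟨ε, hε⟩) p] with n hn
  exact (hjoin _ n p hn).mono hεU

end StraightGeodesics

section Holonomy

variable {X : Type*} [MetricSpace X] {a b c a' b' : X} {δ : ℝ} {n : ℕ}

theorem PathClass.induction_of_isSmall {motive : ∀ {a b : X}, PathClass a b → Prop} (hδ : 0 < δ)
    (small : ∀ {a b : X} (p : Path a b), IsSmall δ p → motive (mk p))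
    (trans : ∀ {a b c : X} (C : PathClass a b) (D : PathClass b c), motive C → motive D →
      motive (C.trans D)) {a b : X} (C : PathClass a b) : motive C := by
  induction C using Path.Homotopic.Quotient.ind with | mk p =>
  obtain ⟨n, hn⟩ := (eventually_isFine hδ p).exists
  induction n generalizing a b with
  | zero => exact small p hn
  | succ n ih =>
    rw [← firstHalf_trans_secondHalf p, mk_trans]
    exact trans _ _ (ih _ hn.1) (ih _ hn.2)

theorem IsFine.succ {p : Path a b} (h : IsFine δ n p) : IsFine δ (n + 1) p := by
  induction n generalizing a b with
  | zero => exact ⟨fun s t => h _ _, fun s t => h _ _⟩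
  | succ n ih => exact ⟨ih h.1, ih h.2⟩

/-- A homomorphism from the fundamental groupoid of `Y` to a group. Products are taken in the order
of composition of functions, as in Mathlib's fundamental group. -/
structure Holonomy (Y Γ : Type*) [TopologicalSpace Y] [Group Γ] where
  /-- The value of the homomorphism on a homotopy class of paths. -/
  hol {a b : Y} : PathClass a b → Γ
  hol_trans {a b c : Y} (C : PathClass a b) (D : PathClass b c) : hol (C.trans D) = hol D * hol C

variable {Γ : Type*} [Group Γ] {Φ : X → X → Γ}

/-- The cocycle condition for triples of points at mutual distance less than `δ`, with products in
the order of `Holonomy`. -/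
def IsLocalCocycle (δ : ℝ) (Φ : X → X → Γ) : Prop :=
  ∀ ⦃a b c⦄, dist a b < δ → dist b c < δ → dist a c < δ → Φ b c * Φ a b = Φ a c

variable (Φ) in
/-- The product of the values of `Φ` along the `n`-th dyadic subdivision of a path. -/
noncomputable def dyadicProd : ℕ → ∀ {a b : X}, Path a b → Γ
  | 0, a, b, _ => Φ a b
  | n + 1, _, _, p => dyadicProd n (secondHalf p) * dyadicProd n (firstHalf p)

theorem dyadicProd_congr {p : Path a b} {p' : Path a' b'} (h : ∀ t, p t = p' t) :
    dyadicProd Φ n p = dyadicProd Φ n p' := by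
  obtain rfl : a = a' := by simpa using h 0
  obtain rfl : b = b' := by simpa using h 1
  rw [Path.ext (funext h)]

theorem dyadicProd_trans (p : Path a b) (q : Path b c) :
    dyadicProd Φ (n + 1) (p.trans q) = dyadicProd Φ n q * dyadicProd Φ n p := by
  refine congrArg₂ (· * ·) (dyadicProd_congr fun t => ?_) (dyadicProd_congr fun t => ?_)
  · refine (Path.trans_apply p q _).trans ?_
    split_ifs with ht
    · obtain rfl : t = 0 := le_antisymm (Subtype.coe_le_coe.1 (by norm_num at ht ⊢; linarith)) t.2.1
      simp
    · exact congrArg q (Subtype.ext (by ring))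
  · have ht : (t / 2 : ℝ) ≤ 1 / 2 := by linarith [t.2.2]
    refine (Path.trans_apply p q _).trans ((dif_pos ht).trans ?_)
    exact congrArg p (Subtype.ext (mul_div_cancel₀ _ two_ne_zero))

namespace IsLocalCocycle

variable (hΦ : IsLocalCocycle δ Φ)
include hΦ

theorem dyadicProd_succ {p : Path a b} (hp : IsFine δ n p) :
    dyadicProd Φ (n + 1) p = dyadicProd Φ n p := by
  induction n generalizing a b with
  | zero =>
    have hmid := hp 0 midTime
    have hmid' := hp midTime 1
    have hends := hp 0 1
    rw [p.source] at hmid hends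
    rw [p.target] at hmid' hends
    exact hΦ hmid hmid' hends
  | succ n ih => exact congrArg₂ (· * ·) (ih hp.2) (ih hp.1)

theorem dyadicProd_eventuallyConst {p : Path a b} (hp : IsFine δ n p) :
    ∀ᶠ m in atTop, dyadicProd Φ m p = dyadicProd Φ n p := by
  have h (m : ℕ) (hm : n ≤ m) : IsFine δ m p ∧ dyadicProd Φ m p = dyadicProd Φ n p := by
    induction m, hm using Nat.le_induction with
    | base => exact ⟨hp, rfl⟩
    | succ m _ ih => exact ⟨ih.1.succ, (hΦ.dyadicProd_succ ih.1).trans ih.2⟩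
  exact eventually_atTop.2 ⟨n, fun m hm => (h m hm).2⟩

theorem mul_dyadicProd {p : Path a b} {p' : Path a' b'} (hp : IsFine (δ / 3) n p)
    (h : ∀ t, dist (p t) (p' t) < δ / 3) :
    Φ b b' * dyadicProd Φ n p = dyadicProd Φ n p' * Φ a a' := by
  induction n generalizing a b a' b' with
  | zero =>
    have hab : dist a b < δ / 3 := by simpa using hp 0 1
    have haa' : dist a a' < δ / 3 := by simpa using h 0
    have hbb' : dist b b' < δ / 3 := by simpa using h 1
    have hab' := dist_triangle a b b'
    have ha'b' := dist_triangle_left a' b' a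
    have hδ := dist_nonneg.trans_lt hab
    exact (hΦ (by linarith) (by linarith) (by linarith)).trans
      (hΦ (by linarith) (by linarith) (by linarith)).symm
  | succ n ih =>
    have h₁ := ih hp.1 (p' := firstHalf p') fun t => h _
    have h₂ := ih hp.2 (p' := secondHalf p') fun t => h _
    simp only [dyadicProd]
    rw [← mul_assoc, h₂, mul_assoc, h₁, mul_assoc]

theorem self (hδ : 0 < δ) (a : X) : Φ a a = 1 := by
  have hd : dist a a < δ := by rwa [dist_self]
  exact mul_eq_left.1 (hΦ hd hd hd)

theorem eventually_dyadicProd_eq (hδ : 0 < δ) (p : Path a b) :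
    ∀ᶠ q in 𝓝 p, ∀ᶠ n in atTop, dyadicProd Φ n q = dyadicProd Φ n p := by
  filter_upwards [nearPaths_mem_nhds p (div_pos hδ three_pos)] with q hq
  filter_upwards [eventually_isFine (div_pos hδ three_pos) p] with n hn
  have h := hΦ.mul_dyadicProd hn (p' := q) fun t => (dist_comm _ _).trans_lt (hq t)
  rw [hΦ.self hδ, hΦ.self hδ, one_mul, mul_one] at h
  exact h.symm

theorem exists_eventually_dyadicProd_eq (hδ : 0 < δ) (C : PathClass a b) :
    ∃ g, ∀ p, mk p = C → ∀ᶠ n in atTop, dyadicProd Φ n p = g := by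
  induction C using Path.Homotopic.Quotient.ind with | mk p =>
  have hlim (q : Path a b) : ∃ g, ∀ᶠ n in atTop, dyadicProd Φ n q = g :=
    (eventually_isFine hδ q).exists.imp' _ fun _ => hΦ.dyadicProd_eventuallyConst
  choose L hL using hlim
  refine ⟨L p, fun q hq => ?_⟩
  obtain ⟨H⟩ := Path.Homotopic.Quotient.eq.1 hq
  have hloc : IsLocallyConstant fun q : Path a b => L q :=
    (IsLocallyConstant.iff_eventually_eq _).2 fun q => by
      filter_upwards [hΦ.eventually_dyadicProd_eq hδ q] with r hr
      obtain ⟨n, hn, hrn, hqn⟩ := (hr.and ((hL r).and (hL q))).exists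
      exact hrn.symm.trans (hn.trans hqn)
  have hcont : Continuous H.eval := Path.continuous_uncurry_iff.1 H.continuous
  have hpq := (hloc.comp_continuous hcont).apply_eq_of_preconnectedSpace 0 1
  simp only [Function.comp_apply, H.eval_zero, H.eval_one] at hpq
  exact hpq ▸ hL q

theorem exists_holonomy (hδ : 0 < δ) : ∃ H : Holonomy X Γ,
    ∀ {a b : X} (p : Path a b), IsSmall δ p → H.hol (mk p) = Φ a b := by
  choose H hH using fun (a b : X) (C : PathClass a b) =>
    hΦ.exists_eventually_dyadicProd_eq hδ C
  refine ⟨⟨H _ _, fun {a b c} C D => ?_⟩, fun {a b} p hp => ?_⟩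
  · induction C using Path.Homotopic.Quotient.ind with | mk p =>
    induction D using Path.Homotopic.Quotient.ind with | mk q =>
    obtain ⟨n, hn, hp, hq⟩ := (((tendsto_add_atTop_nat 1).eventually
      (hH a c _ (p.trans q) (mk_trans p q))).and
        ((hH a b _ p rfl).and (hH b c _ q rfl))).exists
    exact hn.symm.trans ((dyadicProd_trans p q).trans (congrArg₂ _ hq hp))
  · obtain ⟨n, hn, hpn⟩ :=
      ((hH a b _ p rfl).and (hΦ.dyadicProd_eventuallyConst (n := 0) hp)).exists
    exact hn.symm.trans hpn

end IsLocalCocycle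

end Holonomy

section BasedLoops

variable {Y : Type*} [TopologicalSpace Y] {x a b c : Y}

/-- The loop obtained from a path by joining both of its ends to a base point along a fixed system
`K` of paths. -/
noncomputable def basedLoop (K : ∀ a, PathClass x a) (C : PathClass a b) : FundamentalGroup Y x :=
  (K a).trans (C.trans (K b).symm)

variable {K : ∀ a, PathClass x a}

theorem basedLoop_trans (C : PathClass a b) (D : PathClass b c) :
    basedLoop K (C.trans D) = basedLoop K D * basedLoop K C := by
  rw [FundamentalGroup.mul_def]
  simp only [basedLoop, trans_assoc, PathClass.symm_trans_cancel]

theorem basedLoop_eq_one {C : PathClass a b} (h : (K a).trans C = K b) : basedLoop K C = 1 := by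
  rw [basedLoop, ← trans_assoc, h, trans_symm]
  rfl

theorem basedLoop_symm (C : PathClass a b) : basedLoop K C.symm = (basedLoop K C)⁻¹ := by
  rw [eq_inv_iff_mul_eq_one, ← basedLoop_trans, trans_symm]
  exact basedLoop_eq_one (trans_refl _)

theorem basedLoop_eq_self (h : K x = .refl x) (C : PathClass x x) : basedLoop K C = C := by
  rw [basedLoop, h, refl_trans]
  exact trans_refl C

theorem piOneInclusion_basedLoop {M : Set Y} {y : M} {γ : Path x (y : Y)}
    {L : ∀ p : M, PathClass y p} (h : ∀ p : M, K p = (mk γ).trans ((L p).map (subtypeVal M)))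
    {p q : M} (C : PathClass p q) :
    piOneInclusion M y γ (basedLoop L C) = basedLoop K (C.map (subtypeVal M)) := by
  let c : PathClass x (subtypeVal M y) := mk γ
  have hc (p : M) : K (subtypeVal M p) = c.trans ((L p).map (subtypeVal M)) := h p
  change c.trans (((L p).trans (C.trans (L q).symm)).map (subtypeVal M) |>.trans c.symm) =
    (K (subtypeVal M p)).trans ((C.map (subtypeVal M)).trans (K (subtypeVal M q)).symm)
  simp only [PathClass.map_trans, PathClass.map_symm, PathClass.symm_of_trans, hc, trans_assoc]

namespace Holonomy

variable {Γ : Type*} [Group Γ] (H : Holonomy Y Γ)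

theorem hol_refl (a : Y) : H.hol (.refl a) = 1 := by
  have h := H.hol_trans (.refl a) (.refl a)
  rw [trans_refl] at h
  exact left_eq_mul.1 h

/-- The restriction of a holonomy to the fundamental group. -/
def toMonoidHom (x : Y) : FundamentalGroup Y x →* Γ where
  toFun C := H.hol (C : PathClass x x)
  map_one' := H.hol_refl x
  map_mul' C D := H.hol_trans (D : PathClass x x) C

theorem toMonoidHom_basedLoop (h : ∀ a, H.hol (K a) = 1) (C : PathClass a b) :
    H.toMonoidHom x (basedLoop K C) = H.hol C := by
  have hb := H.hol_trans (K b) (K b).symm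
  rw [trans_symm, hol_refl, h, mul_one] at hb
  refine (H.hol_trans _ _).trans ?_
  rw [H.hol_trans, h, ← hb, one_mul, mul_one]

end Holonomy

end BasedLoops

section SingleFactor

variable {ι : Type*} {G : ι → Type*} [∀ i, Group (G i)] {u v w : ∀ i, G i}

open Classical in
/-- The element of the free product given by a family with at most one nontrivial member. -/
noncomputable def singleFactor (u : ∀ i, G i) : CoprodI G :=
  if h : ∃ i, u i ≠ 1 then CoprodI.of (u h.choose) else 1

theorem singleFactor_eq_of (i : ι) (h : ∀ j ≠ i, u j = 1) :
    singleFactor u = CoprodI.of (u i) := by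
  rw [singleFactor]
  split_ifs with hex
  · rw [not_imp_comm.1 (h _) hex.choose_spec]
  · rw [not_exists_not.1 hex i, map_one]

theorem singleFactor_eq_one (h : ∀ i, u i = 1) : singleFactor u = 1 :=
  dif_neg (not_exists_not.2 h)

theorem singleFactor_mul (hw : ∀ i, v i * u i = w i) (hu : Set.Subsingleton {i | u i ≠ 1})
    (hv : Set.Subsingleton {i | v i ≠ 1}) (hw' : Set.Subsingleton {i | w i ≠ 1}) :
    singleFactor v * singleFactor u = singleFactor w := by
  by_cases h : ∃ i, u i ≠ 1
  · obtain ⟨i, hi⟩ := h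
    have hu₁ (j) (hj : j ≠ i) : u j = 1 := by
      by_contra h
      exact hj (hu h hi)
    have hv₁ (j) (hj : j ≠ i) : v j = 1 := by
      by_contra h
      have hvi : v i = 1 := by
        by_contra h'
        exact hj (hv h h')
      refine hj (hw' ?_ ?_)
      · rwa [Set.mem_ofPred_eq, ← hw j, hu₁ j hj, mul_one]
      · rwa [Set.mem_ofPred_eq, ← hw i, hvi, one_mul]
    rw [singleFactor_eq_of i hu₁, singleFactor_eq_of i hv₁, ← map_mul, hw i]
    exact (singleFactor_eq_of i fun j hj => by rw [← hw j, hu₁ j hj, hv₁ j hj, one_mul]).symm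
  · have hu₁ := not_exists_not.1 h
    rw [singleFactor_eq_one hu₁, mul_one]
    exact congrArg _ (funext fun i => by rw [← hw i, hu₁ i, mul_one])

end SingleFactor

namespace StraightGeodesics

section Crossings

variable {X : Type*} [MetricSpace X] {P : Set (Set X)} {G : StraightGeodesics P} {M : P}
  {a b c : X} {δ : ℝ} (hP : IsTreeGrading P)

variable (G) in
/-- The homotopy class, in the piece `M`, of the chosen geodesic between two points of `M`. -/
noncomputable def pieceLine (p q : (M : Set X)) : PathClass p q :=
  lineIn (lineMem_of_mem_piece (G := G) hP p.2 q.2)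

variable (G) in
/-- The paths in the piece `M` from its base point `y` which run through the gate of `x`. -/
noncomputable def pieceComb (x : X) (y p : (M : Set X)) : PathClass y p :=
  (G.pieceLine hP y (G.gate M x)).trans (G.pieceLine hP (G.gate M x) p)

theorem pieceLine_self (p : (M : Set X)) : G.pieceLine hP p p = .refl p :=
  lineIn_self _

theorem pieceLine_symm (p q : (M : Set X)) :
    (G.pieceLine hP p q).symm = G.pieceLine hP q p :=
  lineIn_symm _

theorem pieceComb_self (x : X) (y : (M : Set X)) : G.pieceComb hP x y y = .refl y := by
  rw [pieceComb, ← pieceLine_symm hP y, trans_symm]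

theorem pieceComb_gate_trans (x : X) (y p : (M : Set X)) :
    (G.pieceComb hP x y (G.gate M x)).trans (G.pieceLine hP (G.gate M x) p) =
      G.pieceComb hP x y p := by
  rw [pieceComb, pieceLine_self, trans_refl, pieceComb]

variable {hP} {x : X} {y : (M : Set X)}

theorem basedLoop_pieceLine_gate (p : (M : Set X)) :
    basedLoop (G.pieceComb hP x y) (G.pieceLine hP (G.gate M x) p) = 1 :=
  basedLoop_eq_one (pieceComb_gate_trans hP x y p)

variable (G hP x y) in
/-- The loop in the piece `M` contributed by the geodesic from `a` to `b`. -/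
noncomputable def crossing (a b : X) : FundamentalGroup (M : Set X) y :=
  basedLoop (G.pieceComb hP x y) (G.pieceLine hP (G.gate M a) (G.gate M b))

theorem crossing_eq_one (h : ¬ G.Separates M x a b) : G.crossing hP x y a b = 1 := by
  rw [crossing]
  by_cases hxa : G.gate M x = G.gate M a
  · rw [← hxa, basedLoop_pieceLine_gate]
  by_cases hxb : G.gate M x = G.gate M b
  · rw [← hxb, ← pieceLine_symm, basedLoop_symm, basedLoop_pieceLine_gate, inv_one]
  by_cases hab : G.gate M a = G.gate M b
  · rw [← hab, pieceLine_self]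
    exact basedLoop_eq_one (trans_refl _)
  · exact absurd ⟨hxa, hab, hxb⟩ h

theorem separates_of_crossing_ne_one (h : G.crossing hP x y a b ≠ 1) : G.Separates M x a b :=
  not_imp_comm.1 crossing_eq_one h

theorem crossing_mul (hδ : ∀ o ∈ (M : Set X), PathsHomotopicIn (↑M ∩ Metric.ball o δ) M)
    (hab : dist a b < δ / 2) (hbc : dist b c < δ / 2) :
    G.crossing hP x y b c * G.crossing hP x y a b = G.crossing hP x y a c := by
  rw [crossing, crossing, ← basedLoop_trans]
  exact congrArg _ <| lineIn_triangle_of_mem_piece hP (hδ _ (G.gate M a).2) (G.gate M a).2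
    (G.gate M b).2 (G.gate M c).2 _ _ _ ((dist_gate_le hP).trans_lt hab)
    ((dist_gate_le hP).trans_lt hbc)

theorem mk_eq_pieceLine (hδ : ∀ o ∈ (M : Set X), PathsHomotopicIn (↑M ∩ Metric.ball o δ) M)
    {p q : (M : Set X)} {γ : Path p q} (hγ : IsSmall δ γ) :
    Path.Homotopic.Quotient.mk γ = G.pieceLine hP p q := by
  obtain ⟨_, hpath⟩ := hδ p p.2
  have hmem (t : I) : (γ t : X) ∈ ↑M ∩ Metric.ball (p : X) δ := by
    refine ⟨(γ t).2, ?_⟩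
    simpa [Subtype.dist_eq] using hγ t 0
  have hline : G.LineMem (↑M ∩ Metric.ball (p : X) δ) p q := fun s hs => by
    refine ⟨lineMem_of_mem_piece hP p.2 q.2 hs, lineMem_ball ?_ hs⟩
    simpa [Subtype.dist_eq] using hγ 0 1
  exact hpath _ _ (.mk (restrictPath (γ.map continuous_subtype_val) hmem)) (lineIn hline)

variable {y : ∀ M : P, (M : Set X)}

variable (G hP x y) in
/-- The element of the free product contributed by the geodesic from `a` to `b`. At most one piece
separates `x`, `a` and `b`, and only that piece has a nontrivial crossing. -/
noncomputable def crossingWord (a b : X) :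
    CoprodI fun M : P => FundamentalGroup (M : Set X) (y M) :=
  singleFactor fun M => G.crossing hP x (y M) a b

theorem crossingWord_eq_one (h : ∀ M, ¬ G.Separates M x a b) :
    G.crossingWord hP x y a b = 1 :=
  singleFactor_eq_one fun M => crossing_eq_one (h M)

theorem crossingWord_of_mem_piece (M : P) (p q : (M : Set X)) :
    G.crossingWord hP x y p q =
      CoprodI.of (M := fun M : P => FundamentalGroup (M : Set X) (y M))
        (basedLoop (G.pieceComb hP x (y M)) (G.pieceLine hP p q)) := by
  have hgate (p : (M : Set X)) : G.gate M p = p := Subtype.ext (gate_eq_self p.2)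
  rw [crossingWord, singleFactor_eq_of M fun N hN => crossing_eq_one fun hsep => hsep.ne₂₃ ?_,
    crossing, hgate, hgate]
  exact Subtype.ext <| hP.gate_eq_of_mem_piece N.2 M.2 (Subtype.coe_injective.ne hN) p.2 q.2
    (G.isGate N p) (G.isGate N q)

theorem isLocalCocycle_crossingWord
    (hδ : ∀ M : P, ∀ o ∈ (M : Set X), PathsHomotopicIn (↑M ∩ Metric.ball o δ) M) :
    IsLocalCocycle (δ / 2) (G.crossingWord hP x y) := by
  have hsub (a b : X) : {M | G.crossing hP x (y M) a b ≠ 1}.Subsingleton := fun M hM N hN =>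
    eq_of_separates hP (separates_of_crossing_ne_one hM) (separates_of_crossing_ne_one hN)
  exact fun a b c hab hbc _ =>
    singleFactor_mul (fun M => crossing_mul (hδ M) hab hbc) (hsub a b) (hsub b c) (hsub a c)

end Crossings

end StraightGeodesics

namespace StraightGeodesics

section CrossingHolonomy

variable {X : Type*} [MetricSpace X] {P : Set (Set X)} {G : StraightGeodesics P}
  {hP : IsTreeGrading P} {x : X} {y : ∀ M : P, (M : Set X)}
  {H : Holonomy X (CoprodI fun M : P => FundamentalGroup (M : Set X) (y M))} {δ : ℝ}
  (hH : ∀ {a b : X} (γ : Path a b), IsSmall δ γ → H.hol (.mk γ) = G.crossingWord hP x y a b)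
include hH

theorem hol_map_subtypeVal (hδ : 0 < δ) {η : ℝ} (hδη : δ ≤ η) {M : P}
    (hM : ∀ o ∈ (M : Set X), PathsHomotopicIn (↑M ∩ Metric.ball o η) M) {p q : (M : Set X)}
    (C : PathClass p q) : H.hol (C.map (subtypeVal (M : Set X))) =
      CoprodI.of (M := fun M : P => FundamentalGroup (M : Set X) (y M))
        (basedLoop (G.pieceComb hP x (y M)) C) := by
  refine PathClass.induction_of_isSmall (motive := fun {p q} C =>
    H.hol (C.map (subtypeVal (M : Set X))) =
      CoprodI.of (M := fun M : P => FundamentalGroup (M : Set X) (y M))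
        (basedLoop (G.pieceComb hP x (y M)) C)) hδ (fun γ hγ => ?_) (fun C D hC hD => ?_) C
  · have hline := mk_eq_pieceLine (G := G) (hP := hP) hM fun s t => (hγ s t).trans_le hδη
    refine (hH (γ.map continuous_subtype_val) hγ).trans ?_
    rw [hline, crossingWord_of_mem_piece]
  · rw [PathClass.map_trans, H.hol_trans, hC, hD, basedLoop_trans, map_mul]

theorem hol_line_of_not_separates {a b : X} (hab : dist a b < δ)
    (hsep : ∀ M, ¬ G.Separates M x a b) : H.hol (G.line a b) = 1 :=
  (hH _ (isSmall_linePath hab)).trans (crossingWord_eq_one hsep)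

theorem hol_line_of_between
    (hpiece : ∀ (M : P) (p : (M : Set X)), H.hol (G.line (G.gate M x) p) = 1)
    {a m : X} (hm : dist x a = dist x m + dist m a) (hma : dist m a < δ)
    (hclose : ∀ b, dist x b ≤ dist x m → H.hol (G.line x b) = 1) : H.hol (G.line x a) = 1 := by
  by_cases hsep : ∃ M, G.Separates M x m a
  · obtain ⟨M, hxm, hma', hxa⟩ := hsep
    have hx := dist_gate_left hP hxm
    have ha := dist_gate_left hP hma'.symm
    have hda : dist (G.gate M a : X) a < δ := by
      linarith [dist_comm a m, dist_comm a (G.gate M a),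
        dist_nonneg (x := (G.gate M a : X)) (y := m)]
    rw [← line_gates hP hxa, H.hol_trans, H.hol_trans, hpiece,
      hclose _ (by linarith [dist_nonneg (x := (G.gate M x : X)) (y := m)]),
      hol_line_of_not_separates hH hda fun N hN => not_separates_gate hP hxa.symm hN.reverse,
      one_mul, one_mul]
  · rw [← line_trans hP hm (not_exists.1 hsep), H.hol_trans, hclose m le_rfl,
      hol_line_of_not_separates hH hma (not_exists.1 hsep), one_mul]

theorem hol_line_eq_one (hδ : 0 < δ)
    (hpiece : ∀ (M : P) (p : (M : Set X)), H.hol (G.line (G.gate M x) p) = 1) (a : X) :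
    H.hol (G.line x a) = 1 := by
  obtain ⟨n, hn⟩ := exists_nat_ge (dist x a / (δ / 2))
  rw [div_le_iff₀ (half_pos hδ)] at hn
  induction n generalizing a with
  | zero =>
    obtain rfl : x = a := dist_le_zero.1 (by simpa using hn)
    rw [line_self, H.hol_refl]
  | succ n ih =>
    have hs : max 0 (dist x a - δ / 2) ∈ Icc 0 (dist x a) :=
      ⟨le_max_left _ _, max_le dist_nonneg (by linarith)⟩
    have hxm := (G.isGeod x a).dist_left hs
    have hma := (G.isGeod x a).dist_right hs
    refine hol_line_of_between hH hpiece (m := G.geod x a (max 0 (dist x a - δ / 2)))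
      (by rw [hxm, hma, add_sub_cancel]) ?_ fun b hb => ?_
    · linarith [le_max_right 0 (dist x a - δ / 2)]
    · refine ih b (hb.trans (hxm.trans_le (max_le (by positivity) ?_)))
      push_cast at hn
      linarith

omit hH

theorem exists_holonomy_eq_of (hP : IsTreeGrading P) (hsc : LocallyUniformlySimplyConnected P)
    (x : X) (y : ∀ M : P, (M : Set X)) :
    ∃ H : Holonomy X (CoprodI fun M : P => FundamentalGroup (M : Set X) (y M)),
      (∀ a, H.hol (G.line x a) = 1) ∧ ∀ (M : P) {p q : (M : Set X)} (C : PathClass p q),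
        H.hol (C.map (subtypeVal (M : Set X))) =
          CoprodI.of (M := fun M : P => FundamentalGroup (M : Set X) (y M))
            (basedLoop (G.pieceComb hP x (y M)) C) := by
  obtain ⟨δ, hδ, hball⟩ := hsc 1 one_pos
  have hM (M : P) (o) (ho : o ∈ (M : Set X)) : PathsHomotopicIn (↑M ∩ Metric.ball o δ) M :=
    (hball M M.2 o ho).mono inter_subset_left
  have hcocycle := isLocalCocycle_crossingWord (G := G) (hP := hP) (x := x) (y := y) hM
  obtain ⟨H, hH⟩ := hcocycle.exists_holonomy (half_pos hδ)
  have hmap (M : P) {p q : (M : Set X)} (C : PathClass p q) :=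
    hol_map_subtypeVal hH (half_pos hδ) (half_le_self hδ.le) (hM M) C
  refine ⟨H, hol_line_eq_one hH (half_pos hδ) fun M p => ?_, hmap⟩
  refine (hmap M (G.pieceLine hP (G.gate M x) p)).trans ?_
  rw [basedLoop_pieceLine_gate, map_one]

end CrossingHolonomy

section Surjectivity

variable {X : Type*} [MetricSpace X] {P : Set (Set X)} {G : StraightGeodesics P} {M : P}
  {a b x : X} (hP : IsTreeGrading P)
include hP

theorem line_gate_trans (p : (M : Set X)) :
    (G.line x (G.gate M x)).trans (G.line (G.gate M x) p) = G.line x p := by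
  by_cases hne : G.gate M x = p
  · rw [hne, line_self, trans_refl]
  · have hne' : G.gate M x ≠ G.gate M p := by rwa [Subtype.ext (gate_eq_self p.2)]
    exact line_trans hP (dist_gate_left hP hne') fun _ => not_separates_gate hP hne'

theorem line_eq_trans_pieceComb (y p : (M : Set X)) :
    G.line x p = (G.line x y).trans ((G.pieceComb hP x y p).map (subtypeVal (M : Set X))) := by
  rw [pieceComb, PathClass.map_trans]
  change _ = (G.line x y).trans ((G.line y (G.gate M x)).trans (G.line (G.gate M x) p))
  rw [← line_gate_trans hP p, ← line_gate_trans hP y, trans_assoc,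
    ← line_symm (p := (G.gate M x : X)) (q := y), PathClass.trans_symm_cancel]

theorem basedLoop_line_gate (h : G.gate M a ≠ G.gate M x) :
    basedLoop (G.line x) (G.line (G.gate M a) a) = 1 := by
  have hd := dist_gate_left hP h
  refine basedLoop_eq_one (line_trans hP ?_ fun N hN => not_separates_gate hP h hN.reverse)
  rw [dist_comm x a, hd, dist_comm a, dist_comm x, add_comm]

theorem basedLoop_line_mem {R : Subgroup (FundamentalGroup X x)}
    (hR : ∀ (M : P) (p q : (M : Set X)), basedLoop (G.line x) (G.line p q) ∈ R) (a b : X) :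
    basedLoop (G.line x) (G.line a b) ∈ R := by
  by_cases hsep : ∃ M, G.Separates M x a b
  · obtain ⟨M, hxa, hab, hxb⟩ := hsep
    rw [← line_gates hP hab, ← line_symm (p := (G.gate M a : X)) (q := a), basedLoop_trans,
      basedLoop_trans, basedLoop_symm, basedLoop_line_gate hP hxa.symm,
      basedLoop_line_gate hP hxb.symm, one_mul, inv_one, mul_one]
    exact hR M _ _
  · rw [basedLoop_eq_one (line_triangle hP (not_exists.1 hsep))]
    exact R.one_mem

theorem basedLoop_mem (hsc : LocallyUniformlySimplyConnected P)
    {R : Subgroup (FundamentalGroup X x)}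
    (hR : ∀ (M : P) (p q : (M : Set X)), basedLoop (G.line x) (G.line p q) ∈ R)
    (C : PathClass a b) : basedLoop (G.line x) C ∈ R := by
  obtain ⟨δ, hδ, hline⟩ := exists_mk_eq_line (G := G) hP hsc
  refine PathClass.induction_of_isSmall (motive := fun C => basedLoop (G.line x) C ∈ R) hδ
    (fun γ hγ => ?_) (fun C D hC hD => ?_) C
  · rw [hline γ hγ]
    exact basedLoop_line_mem hP hR _ _
  · rw [basedLoop_trans]
    exact R.mul_mem hD hC

end Surjectivity

end StraightGeodesics

open StraightGeodesics in
theorem mainTheorem12_general {X : Type*} [MetricSpace X] {P : Set (Set X)} (hP : IsTreeGrading P)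
    (hsc : LocallyUniformlySimplyConnected P) (x : X) (y : ∀ M : P, (M : Set X)) :
    ∃ γ : ∀ M : P, Path x (y M : X),
      Function.Bijective
        (CoprodI.lift (fun M : P => piOneInclusion (M : Set X) (y M) (γ M)) :
          CoprodI (fun M : P => FundamentalGroup (M : Set X) (y M)) →* FundamentalGroup X x) := by
  obtain ⟨G⟩ := hP.nonempty_straightGeodesics fun M hM => ⟨_, (y ⟨M, hM⟩).2⟩
  have hincl (M : P) {p q : (M : Set X)} (C : PathClass p q) :
      piOneInclusion (M : Set X) (y M) (G.linePath x (y M)) (basedLoop (G.pieceComb hP x (y M)) C) =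
        basedLoop (G.line x) (C.map (subtypeVal (M : Set X))) :=
    piOneInclusion_basedLoop (line_eq_trans_pieceComb hP (y M)) C
  refine ⟨fun M => G.linePath x (y M), ?_, fun C => ?_⟩
  · obtain ⟨H, hline, hpiece⟩ := exists_holonomy_eq_of (G := G) hP hsc x y
    have hid : (H.toMonoidHom x).comp (CoprodI.lift fun M : P =>
        piOneInclusion (M : Set X) (y M) (G.linePath x (y M))) = MonoidHom.id _ := by
      refine CoprodI.ext_hom _ _ fun M => MonoidHom.ext fun C => ?_
      rw [← basedLoop_eq_self (pieceComb_self hP x (y M)) C, MonoidHom.comp_apply,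
        MonoidHom.comp_apply, CoprodI.lift_of, hincl, H.toMonoidHom_basedLoop hline, hpiece]
      rfl
    exact Function.LeftInverse.injective (g := H.toMonoidHom x) fun u => DFunLike.congr_fun hid u
  · rw [← MonoidHom.mem_range, ← basedLoop_eq_self (K := G.line x) line_self C]
    refine basedLoop_mem hP hsc (fun M p q => ?_) C
    exact ⟨_, (CoprodI.lift_of ..).trans (hincl M (G.pieceLine hP p q))⟩

theorem mainTheorem12 {X : Type*} [MetricSpace X] (P : Set (Set X)) (hP : IsTreeGraded X P)
    (hc : LocallyUniformlyContractible (fun M : P => (M : Set X)))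
    (x : X) (y : ∀ M : P, (M : Set X)) :
    ∃ γ : ∀ M : P, Path x (y M : X),
      Function.Bijective
        (Monoid.CoprodI.lift (fun M : P => piOneInclusion (M : Set X) (y M) (γ M)) :
          Monoid.CoprodI (fun M : P => FundamentalGroup (M : Set X) (y M)) →*
            FundamentalGroup X x) :=
  mainTheorem12_general hP.isTreeGrading hc.locallyUniformlySimplyConnected x y
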